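/- Let $F$ be a finite tree with bipartition $V(F)=A\cup B$ into partite sets with $|A|\le |B|$, put $q=|A|-1$ and assume $q\ge 1$. Let $\delta=\min\{d_F(x):x\in A\}$, and let $\beta(F)$ be the minimum size of a vertex cover of $F$. For a graph $G$ let $\rho(G)$ be the largest eigenvalue of its adjacency matrix, and let $\mathrm{SPEX}(n,F)$ be the set of graphs of order $n$ that contain no subgraph isomorphic to $F$ and that have maximum $\rho$ among all such graphs of order $n$. Let $\mathcal A=\{K_{q+1}\}$ if $\beta(F)=q+1$, and otherwise $$\mathcal A=\{F[S] : S \text{ is a vertex cover of } F \text{ with } |S|\le q\}.$$ Let $\mathrm{EX}(q,\mathcal A)$ be the set of graphs of order $q$ that contain no subgraph isomorphic to a member of $\mathcal A$ and that have the maximum number of edges among all such graphs of order $q$. Write $G\nabla H$ for the join of $G$ and $H$, and $S^0_{n,q}=K_q\nabla (n-q)K_1$. Graphs are considered up to isomorphism. Then there is an integer $N$ (depending on $F$) such that for every $n\ge N$ the following hold: - $\mathrm{SPEX}(n,F)\subseteq\{Q\nabla (n-q)K_1 : Q\in \mathrm{EX}(q,\mathcal A)\}$ if and only if $\delta=1$;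 - (i) $\mathrm{SPEX}(n,F)=\{K_{q,n-q}\}$ if and only if $\delta=1$ and $\mathrm{EX}(q,\mathcal A)=\{qK_1\}$; - (ii) $\mathrm{SPEX}(n,F)=\{S^0_{n,q}\}$ if and only if $\delta=1$ and $\beta(F)=q+1$. -/

import Mathlib

namespace SpectralTree

open SimpleGraph

/-- The join `G ∇ H`: the disjoint union of `G` and `H` together with all edges between them. -/
def join {V W : Type*} (G : SimpleGraph V) (H : SimpleGraph W) : SimpleGraph (V ⊕ W) :=
  (G ⊕g H) ⊔ completeBipartiteGraph V W

/-- The set of graphs with vertex set `Fin n` that are isomorphic to `G`. Sets of `n`-vertex graphs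
"up to isomorphism" are represented by isomorphism-closed sets of graphs on `Fin n`. -/
def isoClass (n : ℕ) {V : Type*} (G : SimpleGraph V) : Set (SimpleGraph (Fin n)) :=
  {H | Nonempty (H ≃g G)}

open Classical in
/-- The spectral radius `ρ(G)`: the largest (real) eigenvalue of the adjacency matrix of `G`. -/
noncomputable def rho {V : Type*} [Fintype V] (G : SimpleGraph V) : ℝ :=
  sSup (spectrum ℝ (G.adjMatrix ℝ))

/-- `SPEX(n, F)`: the `F`-free graphs of order `n` whose spectral radius is maximum among all
`F`-free graphs of order `n`. -/
def SPEX {V : Type*} (n : ℕ) (F : SimpleGraph V) : Set (SimpleGraph (Fin n)) :=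
  {G | F.Free G ∧ ∀ G' : SimpleGraph (Fin n), F.Free G' → rho G' ≤ rho G}

/-- A family of finite graphs. -/
abbrev GraphFamily : Type := Set (Σ k : ℕ, SimpleGraph (Fin k))

/-- `G` contains no copy (as a not necessarily induced subgraph) of a member of `𝒜`. -/
def FamilyFree {W : Type*} (𝒜 : GraphFamily) (G : SimpleGraph W) : Prop :=
  ∀ H ∈ 𝒜, H.2.Free G

open Classical in
/-- `EX(n, 𝒜)`: the `𝒜`-free graphs of order `n` with the maximum number of edges. -/
def EX (n : ℕ) (𝒜 : GraphFamily) : Set (SimpleGraph (Fin n)) :=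
  {Q | Q.IsExtremal (FamilyFree 𝒜)}

open Classical in
/-- The family `𝒜`: it is `{K_{q+1}}` if `β(F) = q + 1`, and otherwise it consists of the induced
subgraphs `F[S]` where `S` is a covering (vertex cover) of `F` with `|S| ≤ q`. Members are taken up
to isomorphism. -/
noncomputable def coverFamily {V : Type*} (F : SimpleGraph V) (q : ℕ) : GraphFamily :=
  if F.vertexCoverNum = ((q + 1 : ℕ) : ℕ∞) then
    {H | Nonempty (H.2 ≃g (⊤ : SimpleGraph (Fin (q + 1))))}
  else
    {H | ∃ S : Finset V, F.IsVertexCover (S : Set V) ∧ S.card ≤ q ∧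
      Nonempty (H.2 ≃g F.induce (S : Set V))}

/-- `ℋ(n, q, 𝒜)`: the graphs of order `n` of the form `Q ∇ (n - q)K₁` with `Q ∈ EX(q, 𝒜)`. -/
def joinFamily (n q : ℕ) (𝒜 : GraphFamily) : Set (SimpleGraph (Fin n)) :=
  {G | ∃ Q ∈ EX q 𝒜, Nonempty (G ≃g join Q (⊥ : SimpleGraph (Fin (n - q))))}

/-- `S_{n,k}^0 = K_k ∇ (n - k)K₁`. -/
def S0 (n k : ℕ) : SimpleGraph (Fin k ⊕ Fin (n - k)) :=
  join (⊤ : SimpleGraph (Fin k)) (⊥ : SimpleGraph (Fin (n - k)))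

open Classical in
/-- The minimum of the degrees `d_F(x)` over `x ∈ A` (used for nonempty `A`). -/
noncomputable def minDegreeOn {V : Type*} [Fintype V] (F : SimpleGraph V) (A : Finset V) : ℕ :=
  sInf ((fun x => F.degree x) '' (A : Set V))

end SpectralTree

namespace SpectralTree

open SimpleGraph Finset
open scoped Classical

/-! ### Degeneracy of graphs without a given tree -/

section Combinatorics

universe u

variable {V α : Type*}

/-! A tree embeds in any graph of large minimum degree, so an `F`-free graph has a degenerate order;
and since one side of `F` has `q + 1` vertices, no `q + 1` vertices have many common neighbours. As
the complete bipartite graph with sides `q` and `n - q` is `F`-free, an extremal `G` satisfies `ρ² ≥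
q(n - q)`. Only boundedly many vertices have linear degree, and the quadratic form of the Perron
vector is carried almost entirely by the edges between them and the rest. Near-equality in
Cauchy–Schwarz then forces almost all vertices to be joined to the same `q`-set `L`
(`exists_common_neighbourhood`).

Suppose `A` contains a leaf. A common neighbour of `L` with a neighbour outside `L` would complete a
copy of `F` (`isContained_of_leaf`). If some vertices outside `L` still miss part of `L`, rewiring
all vertices outside `L` to exactly `L` keeps the graph `F`-free and raises `ρ`
(`eq_empty_of_rho_joinOutside_le`). Hence `G` is a join of some `Q` on `q` vertices with an
independent set. Such a join is `F`-free exactly when `Q` avoids the subgraphs `F[S]` for small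
covers `S` (`free_join_bot_iff`), and for large `n` its spectral radius is ordered by the number of
edges of `Q` (`rho_join_lt_of_card_lt`), so `Q` is edge-extremal.

If every vertex of `A` has degree at least two, an edge count in the forest `F` shows that one edge
can be added on the independent side, even over a complete `Q`, without creating `F`
(`free_join_top_edge`); so no such join is extremal. Statements (i) and (ii) follow from this and
from strict monotonicity of `ρ` below a connected graph. -/

/-- A vertex ordering in which every vertex has at most `C` later neighbours. -/
def IsDegenerateOrder (G : SimpleGraph α) (S : Finset α) (C : ℕ) (f : α → ℕ) : Prop :=
  Set.InjOn f S ∧ ∀ v ∈ S, #{w ∈ S | G.Adj v w ∧ f v < f w} ≤ C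

theorem isContained_of_injective {F : SimpleGraph V} {G : SimpleGraph α} (f : V → α)
    (hf : Function.Injective f) (h : ∀ u v, F.Adj u v → G.Adj (f u) (f v)) : F ⊑ G :=
  ⟨⟨⟨f, fun {u v} huv => h u v huv⟩, hf⟩⟩

/-- A tree on `k` vertices embeds in any nonempty vertex set of internal minimum degree at
least `k`. -/
theorem IsTree.exists_embedding_of_degree {α : Type*} {G : SimpleGraph α} {S : Finset α}
    (hS : S.Nonempty) (k : ℕ) (hdeg : ∀ v ∈ S, k ≤ #{w ∈ S | G.Adj v w}) :
    ∀ (m : ℕ), m ≤ k → ∀ {V : Type u} [Fintype V] (F : SimpleGraph V), F.IsTree →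
      Fintype.card V = m → ∃ f : V → α, Function.Injective f ∧ (∀ v, f v ∈ S) ∧
        ∀ u v, F.Adj u v → G.Adj (f u) (f v) := by
  intro m
  induction m with
  | zero =>
    intro _ V _ F hF hV
    have := hF.connected.nonempty
    exact absurd hV Fintype.card_ne_zero
  | succ m ih =>
    intro hm V _ F hF hV
    rcases Nat.eq_zero_or_pos m with rfl | hmpos
    · obtain ⟨s, hs⟩ := hS
      have hsub : Subsingleton V := Fintype.card_le_one_iff_subsingleton.1 (by lia)
      refine ⟨fun _ => s, fun u v _ => Subsingleton.elim u v, fun _ => hs, ?_⟩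
      intro u v huv
      exact absurd (Subsingleton.elim u v) huv.ne
    · have : Nontrivial V := Fintype.one_lt_card_iff_nontrivial.1 (by lia)
      obtain ⟨x, hx⟩ := hF.exists_vert_degree_one_of_nontrivial
      have htree : (F.induce {x}ᶜ).IsTree :=
        ⟨hF.connected.induce_compl_singleton_of_degree_eq_one hx, hF.isAcyclic.induce _⟩
      have hcard : Fintype.card ({x}ᶜ : Set V) = m := by
        rw [Fintype.card_compl_set]; simp [hV]
      obtain ⟨f, hinj, hmem, hadj⟩ := ih (by lia) (F.induce {x}ᶜ) htree hcard
      obtain ⟨y, hy⟩ := Finset.card_eq_one.1 hx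
      have hxy : F.Adj x y := by
        have : y ∈ F.neighborFinset x := by rw [hy]; simp
        simpa using this
      have honly : ∀ z, F.Adj x z → z = y := by
        intro z hz
        have : z ∈ F.neighborFinset x := by simpa using hz
        rw [hy] at this; simpa using this
      let y' : ({x}ᶜ : Set V) := ⟨y, by simpa using hxy.ne'⟩
      -- The image of the parent `y` of the deleted leaf has at least `k > m` neighbours in `S`, and
      -- only `m` vertices are used so far.
      obtain ⟨t, ht, htn⟩ : ∃ t ∈ ({w ∈ S | G.Adj (f y') w} : Finset α),
          t ∉ (univ.image f : Finset α) := by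
        apply Finset.exists_mem_notMem_of_card_lt_card
        have h1 := hdeg _ (hmem y')
        have h2 : #(univ.image f : Finset α) ≤ m := by
          refine Finset.card_image_le.trans ?_
          rw [Finset.card_univ, hcard]
        lia
      rw [mem_filter] at ht
      have htf : ∀ z, f z ≠ t := fun z hz => htn (by simp [← hz])
      refine ⟨fun v => if h : v = x then t else f ⟨v, by simpa using h⟩, ?_, ?_, ?_⟩
      · intro u v huv
        by_cases hu : u = x <;> by_cases hv : v = x
        · rw [hu, hv]
        · simp [hu, hv] at huv
          exact absurd huv.symm (htf _)
        · simp [hu, hv] at huv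
          exact absurd huv (htf _)
        · simp [hu, hv] at huv
          simpa using hinj huv
      · intro v
        by_cases hv : v = x
        · simp [hv, ht.1]
        · simp [hv, hmem]
      · intro u v huv
        by_cases hu : u = x <;> by_cases hv : v = x
        · exact absurd (hu.trans hv.symm) huv.ne
        · have : v = y := honly v (hu ▸ huv)
          subst this
          simp only [hu, hv, dite_true, dite_false]
          exact ht.2.symm
        · have : u = y := honly u (hv ▸ huv.symm)
          subst this
          simp only [hu, hv, dite_true, dite_false]
          exact ht.2
        · simp only [hu, hv, dite_false]
          exact hadj _ _ huv

theorem exists_isDegenerateOrder [Fintype V] {F : SimpleGraph V} (hF : F.IsTree)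
    {G : SimpleGraph α} (hfree : F.Free G) (S : Finset α) :
    ∃ f, IsDegenerateOrder G S (Fintype.card V) f := by
  induction S using Finset.strongInduction with
  | H S ih =>
    rcases S.eq_empty_or_nonempty with rfl | hS
    · exact ⟨fun _ => 0, by simp [IsDegenerateOrder]⟩
    · obtain ⟨v, hv, hdv⟩ : ∃ v ∈ S, #{w ∈ S | G.Adj v w} < Fintype.card V := by
        by_contra! h
        obtain ⟨f, hinj, -, hadj⟩ :=
          IsTree.exists_embedding_of_degree hS (Fintype.card V) h _ le_rfl F hF rfl
        exact hfree (isContained_of_injective f hinj hadj)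
      obtain ⟨f, hinj, hdeg⟩ := ih (S.erase v) (Finset.erase_ssubset hv)
      -- A vertex of small internal degree goes first; it is then nobody's later neighbour.
      refine ⟨fun w => if w = v then 0 else f w + 1, ?_, ?_⟩
      · intro a ha b hb hab
        by_cases hav : a = v <;> by_cases hbv : b = v
        · rw [hav, hbv]
        · simp [hav, hbv] at hab
        · simp [hav, hbv] at hab
        · simp [hav, hbv] at hab
          exact hinj (by simpa [hav] using ha) (by simpa [hbv] using hb) hab
      · intro u hu
        by_cases huv : u = v
        · subst huv
          refine le_trans (Finset.card_le_card ?_) hdv.le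
          intro w hw
          simp only [mem_filter] at hw ⊢
          exact ⟨hw.1, hw.2.1⟩
        · refine le_trans (Finset.card_le_card ?_) (hdeg u (by simp [huv, hu]))
          intro w hw
          simp only [mem_filter, huv, if_false, mem_erase] at hw ⊢
          by_cases hwv : w = v
          · simp [hwv] at hw
          · simp [hwv] at hw
            exact ⟨⟨hwv, hw.1⟩, hw.2.1, by lia⟩

theorem IsDegenerateOrder.mono {G : SimpleGraph α} {S T : Finset α} {C : ℕ} {f : α → ℕ}
    (h : IsDegenerateOrder G S C f) (hT : T ⊆ S) : IsDegenerateOrder G T C f :=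
  ⟨h.1.mono (by exact_mod_cast hT), fun v hv =>
    (Finset.card_le_card (Finset.filter_subset_filter _ hT)).trans (h.2 v (hT hv))⟩

/-- Summing a symmetric function over ordered adjacent pairs counts each oriented edge twice. -/
theorem IsDegenerateOrder.sum_adj {G : SimpleGraph α} {S : Finset α} {C : ℕ} {f : α → ℕ}
    (h : IsDegenerateOrder G S C f) (g : α → α → ℝ) (hg : ∀ u v, g u v = g v u) :
    ∑ u ∈ S, ∑ v ∈ S, (if G.Adj u v then g u v else 0) =
      2 * ∑ u ∈ S, ∑ v ∈ S, (if G.Adj u v ∧ f u < f v then g u v else 0) := by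
  have h1 : ∑ u ∈ S, ∑ v ∈ S, (if G.Adj u v then g u v else 0) =
      ∑ u ∈ S, ∑ v ∈ S, ((if G.Adj u v ∧ f u < f v then g u v else 0) +
        (if G.Adj v u ∧ f v < f u then g v u else 0)) := by
    refine Finset.sum_congr rfl fun u hu => Finset.sum_congr rfl fun v hv => ?_
    by_cases huv : G.Adj u v
    · have hne : f u ≠ f v := fun e => huv.ne (h.1 hu hv e)
      rcases lt_or_gt_of_ne hne with hlt | hlt
      · simp [huv, huv.symm, hlt, hlt.le.not_gt]
      · simp [huv, huv.symm, hlt, hlt.le.not_gt, hg u v]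
    · have : ¬ G.Adj v u := fun e => huv e.symm
      simp [huv, this]
  rw [h1]
  simp only [Finset.sum_add_distrib]
  rw [Finset.sum_comm (f := fun u v => if G.Adj v u ∧ f v < f u then g v u else 0)]
  ring

theorem IsDegenerateOrder.sum_later_le {G : SimpleGraph α} {S : Finset α} {C : ℕ} {f : α → ℕ}
    (h : IsDegenerateOrder G S C f) (g : α → ℝ) (hg : ∀ v ∈ S, 0 ≤ g v) :
    ∑ u ∈ S, ∑ v ∈ S, (if G.Adj u v ∧ f u < f v then g u else 0) ≤ C * ∑ u ∈ S, g u := by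
  rw [Finset.mul_sum]
  refine Finset.sum_le_sum fun u hu => ?_
  rw [← Finset.sum_filter, Finset.sum_const, nsmul_eq_mul]
  exact mul_le_mul_of_nonneg_right (by exact_mod_cast h.2 u hu) (hg u hu)

/-- The edge weight of a bounded function on a degenerate graph. -/
theorem IsDegenerateOrder.sum_adj_le_of_le {G : SimpleGraph α} {S : Finset α} {C : ℕ}
    {f : α → ℕ} (h : IsDegenerateOrder G S C f) (x : α → ℝ) (hx : ∀ v ∈ S, 0 ≤ x v) (m : ℝ)
    (hm : ∀ v ∈ S, x v ≤ m) :
    ∑ u ∈ S, ∑ v ∈ S, (if G.Adj u v then x u * x v else 0) ≤ 2 * (C * m) * ∑ u ∈ S, x u := by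
  rw [h.sum_adj (fun u v => x u * x v) (fun u v => mul_comm _ _)]
  have h1 : ∑ u ∈ S, ∑ v ∈ S, (if G.Adj u v ∧ f u < f v then x u * x v else 0) ≤
      ∑ u ∈ S, ∑ v ∈ S, (if G.Adj u v ∧ f u < f v then x u * m else 0) := by
    refine Finset.sum_le_sum fun u hu => Finset.sum_le_sum fun v hv => ?_
    split_ifs
    · exact mul_le_mul_of_nonneg_left (hm v hv) (hx u hu)
    · exact le_rfl
  have h2 := h.sum_later_le (fun u => x u * m)
    (fun v hv => mul_nonneg (hx v hv) ((hx v hv).trans (hm v hv)))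
  rw [← Finset.sum_mul] at h2
  nlinarith

theorem IsDegenerateOrder.sum_degree_le {G : SimpleGraph α} {S : Finset α} {C : ℕ}
    {f : α → ℕ} (h : IsDegenerateOrder G S C f) :
    ∑ u ∈ S, (#{v ∈ S | G.Adj u v} : ℝ) ≤ 2 * C * #S := by
  have := h.sum_adj_le_of_le (fun _ => 1) (by simp) 1 (by simp)
  simpa [Finset.sum_boole] using this

/-- The quadratic form of a degenerate graph of bounded degree. -/
theorem IsDegenerateOrder.sum_adj_le_of_degree {G : SimpleGraph α} {S : Finset α} {C : ℕ}
    {f : α → ℕ} (h : IsDegenerateOrder G S C f) (x : α → ℝ) (D t : ℝ) (ht : 0 < t)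
    (hD : ∀ v ∈ S, (#{w ∈ S | G.Adj v w} : ℝ) ≤ D) :
    ∑ u ∈ S, ∑ v ∈ S, (if G.Adj u v then x u * x v else 0) ≤
      (C * t + D / t) * ∑ u ∈ S, x u ^ 2 := by
  rw [h.sum_adj (fun u v => x u * x v) (fun u v => mul_comm _ _)]
  -- Weighted AM-GM on each oriented edge: the tail is charged with weight `t`, at most `C` times,
  -- and the head with weight `1 / t`, at most `D` times.
  have h1 : 2 * ∑ u ∈ S, ∑ v ∈ S, (if G.Adj u v ∧ f u < f v then x u * x v else 0) ≤
      ∑ u ∈ S, ∑ v ∈ S, (if G.Adj u v ∧ f u < f v then t * x u ^ 2 else 0) +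
      ∑ u ∈ S, ∑ v ∈ S, (if G.Adj u v then x v ^ 2 / t else 0) := by
    rw [Finset.mul_sum, ← Finset.sum_add_distrib]
    refine Finset.sum_le_sum fun u hu => ?_
    rw [Finset.mul_sum, ← Finset.sum_add_distrib]
    refine Finset.sum_le_sum fun v hv => ?_
    by_cases huv : G.Adj u v
    · by_cases hf : f u < f v
      · simp only [huv, hf, and_self, if_true]
        have : t * x u ^ 2 + x v ^ 2 / t - 2 * (x u * x v) = (t * x u - x v) ^ 2 / t := by
          field_simp; ring
        have h0 : 0 ≤ (t * x u - x v) ^ 2 / t := by positivity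
        linarith
      · simp only [huv, hf, and_false, if_true, if_false]
        have : 0 ≤ x v ^ 2 / t := by positivity
        linarith
    · simp [huv]
  have h2 := h.sum_later_le (fun u => t * x u ^ 2) (fun v _ => by positivity)
  have h3 : ∑ u ∈ S, ∑ v ∈ S, (if G.Adj u v then x v ^ 2 / t else 0) ≤
      D / t * ∑ u ∈ S, x u ^ 2 := by
    rw [Finset.sum_comm, Finset.mul_sum]
    refine Finset.sum_le_sum fun v hv => ?_
    simp only [G.adj_comm _ v]
    rw [← Finset.sum_filter, Finset.sum_const, nsmul_eq_mul]
    have : D / t * x v ^ 2 = D * (x v ^ 2 / t) := by ring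
    rw [this]
    exact mul_le_mul_of_nonneg_right (hD v hv) (by positivity)
  rw [← Finset.mul_sum] at h2
  nlinarith

end Combinatorics

/-! ### Perron vectors and monotonicity of the spectral radius -/

section SpectralRadius

variable {V W : Type*} [Fintype V] [Fintype W]

/-- The sum of `x` over the neighbours of `v`. -/
noncomputable def nbrSum (G : SimpleGraph V) (x : V → ℝ) (v : V) : ℝ :=
  ∑ w, if G.Adj v w then x w else 0

theorem adjMatrix_mulVec_eq_nbrSum (G : SimpleGraph V) (x : V → ℝ) (v : V) :
    (G.adjMatrix ℝ).mulVec x v = nbrSum G x v := by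
  simp [nbrSum, Matrix.mulVec, dotProduct, SimpleGraph.adjMatrix_apply]

theorem isHermitian_adjMatrix {U : Type*} (G : SimpleGraph U) : (G.adjMatrix ℝ).IsHermitian := by
  ext u v
  simp [SimpleGraph.adjMatrix_apply, G.adj_comm]

theorem posSemidef_rho_sub (G : SimpleGraph V) :
    (algebraMap ℝ (Matrix V V ℝ) (rho G) - G.adjMatrix ℝ).PosSemidef := by
  have hA := isHermitian_adjMatrix G
  rw [Matrix.posSemidef_iff_isHermitian_and_spectrum_nonneg]
  refine ⟨?_, ?_⟩
  · refine Matrix.IsHermitian.sub ?_ hA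
    rw [Matrix.IsHermitian, Algebra.algebraMap_eq_smul_one, Matrix.conjTranspose_smul]
    simp
  · rw [← spectrum.singleton_sub_eq]
    rintro a ⟨r, hr, s, hs, rfl⟩
    rw [Set.mem_singleton_iff] at hr
    subst hr
    have hb : BddAbove (spectrum ℝ (G.adjMatrix ℝ)) := by
      rw [hA.spectrum_real_eq_range_eigenvalues]
      exact (Set.finite_range _).bddAbove
    have : s ≤ rho G := le_csSup hb hs
    simpa using this

theorem dotProduct_rho_sub (G : SimpleGraph V) (x : V → ℝ) :
    star x ⬝ᵥ (algebraMap ℝ (Matrix V V ℝ) (rho G) - G.adjMatrix ℝ).mulVec x =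
      rho G * ∑ v, x v ^ 2 - ∑ v, x v * nbrSum G x v := by
  rw [Matrix.sub_mulVec, Algebra.algebraMap_eq_smul_one, Matrix.smul_mulVec, Matrix.one_mulVec,
    dotProduct_sub, Finset.mul_sum]
  simp only [dotProduct, adjMatrix_mulVec_eq_nbrSum, Pi.smul_apply, smul_eq_mul, star_trivial]
  congr 1
  exact Finset.sum_congr rfl fun v _ => by ring

theorem quadForm_le_rho (G : SimpleGraph V) (x : V → ℝ) :
    ∑ v, x v * nbrSum G x v ≤ rho G * ∑ v, x v ^ 2 := by
  have := (posSemidef_rho_sub G).dotProduct_mulVec_nonneg x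
  rw [dotProduct_rho_sub] at this
  linarith

/-- A positive semidefinite form vanishes only on the kernel of its matrix. This turns equality in a
Rayleigh estimate into an eigenvector equation, with no appeal to Perron–Frobenius. -/
theorem nbrSum_eq_of_quadForm_eq (G : SimpleGraph V) (x : V → ℝ)
    (h : rho G * ∑ v, x v ^ 2 ≤ ∑ v, x v * nbrSum G x v) (v : V) :
    nbrSum G x v = rho G * x v := by
  have h0 : star x ⬝ᵥ (algebraMap ℝ (Matrix V V ℝ) (rho G) - G.adjMatrix ℝ).mulVec x = 0 := by
    rw [dotProduct_rho_sub]
    linarith [quadForm_le_rho G x]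
  have h1 := congrFun (((posSemidef_rho_sub G).dotProduct_mulVec_zero_iff x).1 h0) v
  rw [Matrix.sub_mulVec, Algebra.algebraMap_eq_smul_one, Matrix.smul_mulVec,
    Matrix.one_mulVec] at h1
  simp only [Pi.sub_apply, adjMatrix_mulVec_eq_nbrSum, Pi.smul_apply, smul_eq_mul,
    Pi.zero_apply] at h1
  linarith

theorem nbrSum_nonneg {G : SimpleGraph V} {x : V → ℝ} (h : ∀ v, 0 ≤ x v) (v : V) :
    0 ≤ nbrSum G x v :=
  Finset.sum_nonneg fun w _ => by split_ifs <;> simp [h]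

/-- Existence of a nonnegative eigenvector for the spectral radius. -/
theorem exists_perron [Nonempty V] (G : SimpleGraph V) :
    ∃ x : V → ℝ, (∀ v, 0 ≤ x v) ∧ ∑ v, x v ^ 2 = 1 ∧ ∀ v, nbrSum G x v = rho G * x v := by
  have hA := isHermitian_adjMatrix G
  have hmem : rho G ∈ spectrum ℝ (G.adjMatrix ℝ) := by
    unfold rho
    rw [hA.spectrum_real_eq_range_eigenvalues]
    exact (Set.range_nonempty _).csSup_mem (Set.finite_range _)
  rw [← Matrix.spectrum_toLin', ← Module.End.hasEigenvalue_iff_mem_spectrum] at hmem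
  obtain ⟨z, hz⟩ := hmem.exists_hasEigenvector
  have hz1 : ∀ v, nbrSum G z v = rho G * z v := by
    intro v
    have := congrFun hz.apply_eq_smul v
    rw [Matrix.toLin'_apply, adjMatrix_mulVec_eq_nbrSum] at this
    simpa using this
  have hpos : 0 < ∑ v, z v ^ 2 := by
    obtain ⟨v, hv⟩ := Function.ne_iff.1 hz.2
    exact Finset.sum_pos' (fun v _ => sq_nonneg _) ⟨v, mem_univ _, sq_pos_of_ne_zero (by simpa using hv)⟩
  set c := Real.sqrt (∑ v, z v ^ 2) with hc
  have hcpos : 0 < c := Real.sqrt_pos.2 hpos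
  have hcsq : c ^ 2 = ∑ v, z v ^ 2 := Real.sq_sqrt hpos.le
  -- Taking absolute values does not decrease the quadratic form, so `|z|` also attains the maximum.
  have habs : ∀ v, nbrSum G (fun v => |z v|) v = rho G * |z v| := by
    refine nbrSum_eq_of_quadForm_eq G _ ?_
    simp only [sq_abs]
    rw [Finset.mul_sum]
    refine Finset.sum_le_sum fun v _ => ?_
    have h1 : rho G * z v ^ 2 = z v * nbrSum G z v := by rw [hz1]; ring
    rw [h1]
    calc z v * nbrSum G z v ≤ |z v| * |nbrSum G z v| := by
          rw [← abs_mul]; exact le_abs_self _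
      _ ≤ |z v| * nbrSum G (fun v => |z v|) v := by
          refine mul_le_mul_of_nonneg_left ?_ (abs_nonneg _)
          refine (Finset.abs_sum_le_sum_abs _ _).trans (Finset.sum_le_sum fun w _ => ?_)
          split_ifs <;> simp
  refine ⟨fun v => |z v| / c, fun v => by positivity, ?_, fun v => ?_⟩
  · simp only [div_pow, sq_abs]
    rw [← Finset.sum_div, ← hcsq, div_self (by positivity)]
  · have : nbrSum G (fun v => |z v| / c) v = nbrSum G (fun v => |z v|) v / c := by
      unfold nbrSum
      rw [Finset.sum_div]
      exact Finset.sum_congr rfl fun w _ => by split_ifs <;> simp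
    rw [this, habs]
    ring

theorem rho_nonneg [Nonempty V] (G : SimpleGraph V) : 0 ≤ rho G := by
  obtain ⟨x, hx, hx1, hxe⟩ := exists_perron G
  obtain ⟨v, -, hv⟩ := Finset.exists_ne_zero_of_sum_ne_zero (hx1.trans_ne one_ne_zero)
  have hv' : 0 < x v := lt_of_le_of_ne (hx v) fun h => hv (by simp [← h])
  have := nbrSum_nonneg (G := G) hx v
  rw [hxe] at this
  exact nonneg_of_mul_nonneg_left this hv'

theorem nbrSum_comp_iso {G : SimpleGraph V} {H : SimpleGraph W} (e : G ≃g H) (x : W → ℝ) (v : V) :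
    nbrSum G (fun v => x (e v)) v = nbrSum H x (e v) := by
  unfold nbrSum
  rw [← e.toEquiv.sum_comp]
  exact Finset.sum_congr rfl fun w _ => by
    change _ = if H.Adj (e v) (e w) then x (e w) else 0
    simp [e.map_adj_iff]

theorem rho_le_of_iso {G : SimpleGraph V} {H : SimpleGraph W} [Nonempty V] (e : G ≃g H) :
    rho H ≤ rho G := by
  have : Nonempty W := ⟨e (Classical.arbitrary V)⟩
  obtain ⟨x, hx, hx1, hxe⟩ := exists_perron H
  have h1 := quadForm_le_rho G (fun v => x (e v))
  have h2 : ∑ v, x (e v) ^ 2 = 1 := by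
    rw [← hx1]; exact e.toEquiv.sum_comp (fun w => x w ^ 2)
  have h3 : ∑ v, x (e v) * nbrSum G (fun v => x (e v)) v = rho H := by
    simp only [nbrSum_comp_iso, hxe]
    calc ∑ v, x (e v) * (rho H * x (e v)) = rho H * ∑ v, x (e v) ^ 2 := by
          rw [Finset.mul_sum]; exact Finset.sum_congr rfl fun v _ => by ring
      _ = rho H := by rw [h2, mul_one]
  rw [h2, h3, mul_one] at h1
  exact h1

theorem rho_congr {G : SimpleGraph V} {H : SimpleGraph W} [Nonempty V] (e : G ≃g H) :
    rho G = rho H := by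
  have : Nonempty W := ⟨e (Classical.arbitrary V)⟩
  exact le_antisymm (rho_le_of_iso e.symm) (rho_le_of_iso e)

/-- A nonnegative eigenvector of a connected graph that vanishes somewhere vanishes. -/
theorem eq_zero_of_reachable {G : SimpleGraph V} {x : V → ℝ} {c : ℝ} (hx : ∀ v, 0 ≤ x v)
    (hxe : ∀ v, nbrSum G x v = c * x v) {u v : V} (huv : G.Reachable u v) (hu : x u = 0) :
    x v = 0 := by
  obtain ⟨p⟩ := huv
  induction p with
  | nil => exact hu
  | @cons a b d hab p ih =>
    apply ih
    have h1 := hxe a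
    rw [hu, mul_zero] at h1
    have h2 := (Finset.sum_eq_zero_iff_of_nonneg
      (fun w _ => by split_ifs <;> simp [hx])).1 h1 b (mem_univ _)
    simpa [hab] using h2

/-- The spectral radius strictly increases when edges are added to reach a connected graph. -/
theorem rho_lt_of_lt [Nonempty V] {G H : SimpleGraph V} (h : G < H) (hH : H.Connected) :
    rho G < rho H := by
  obtain ⟨x, hx, hx1, hxe⟩ := exists_perron G
  obtain ⟨u, v, huv, hnuv⟩ : ∃ u v, H.Adj u v ∧ ¬ G.Adj u v := by
    by_contra! hc
    exact h.not_ge fun a b hab => hc a b hab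
  have hle : ∀ w, nbrSum G x w ≤ nbrSum H x w := fun w =>
    Finset.sum_le_sum fun z _ => by
      by_cases hz : G.Adj w z
      · simp [hz, h.le hz]
      · simp only [hz, if_false]; split_ifs <;> simp [hx]
  have hsum : ∑ w, x w * nbrSum G x w = rho G := by
    simp only [hxe]
    calc ∑ w, x w * (rho G * x w) = rho G * ∑ w, x w ^ 2 := by
          rw [Finset.mul_sum]; exact Finset.sum_congr rfl fun v _ => by ring
      _ = rho G := by rw [hx1, mul_one]
  by_contra! hc
  have hq : rho H * ∑ v, x v ^ 2 ≤ ∑ v, x v * nbrSum H x v := by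
    rw [hx1, mul_one]
    refine hc.trans ?_
    rw [← hsum]
    exact Finset.sum_le_sum fun w _ => mul_le_mul_of_nonneg_left (hle w) (hx w)
  have hxe' := nbrSum_eq_of_quadForm_eq H x hq
  have hlt : nbrSum H x u ≤ nbrSum G x u := by
    rw [hxe', hxe]; exact mul_le_mul_of_nonneg_right hc (hx u)
  have hv0 : x v = 0 := by
    have h1 : nbrSum G x u + x v ≤ nbrSum H x u := by
      unfold nbrSum
      rw [← Finset.add_sum_erase _ _ (mem_univ v), ← Finset.add_sum_erase _ _ (mem_univ v)]
      simp only [hnuv, huv, if_false, if_true, zero_add]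
      rw [add_comm]
      refine add_le_add le_rfl (Finset.sum_le_sum fun z _ => ?_)
      by_cases hz : G.Adj u z
      · simp [hz, h.le hz]
      · simp only [hz, if_false]; split_ifs <;> simp [hx]
    linarith [hx v]
  have hall : ∀ w, x w = 0 := fun w => eq_zero_of_reachable hx hxe' (hH.preconnected v w) hv0
  simp [hall] at hx1

end SpectralRadius

/-! ### Concentration of neighbourhoods on a single `q`-set -/

section Structure

variable {α : Type*}

theorem sq_sum_le_card_mul {T H : Finset α} (hT : T ⊆ H) (x : α → ℝ) :
    (∑ h ∈ T, x h) ^ 2 ≤ #T * ∑ h ∈ H, x h ^ 2 :=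
  sq_sum_le_card_mul_sum_sq.trans (mul_le_mul_of_nonneg_left
    (Finset.sum_le_sum_of_subset_of_nonneg hT fun _ _ _ => sq_nonneg _) (by positivity))

theorem card_eq_of_sq_sum_large {q : ℕ} {T H : Finset α} {x : α → ℝ} {b : ℝ} (hb : 0 < b)
    (hbH : ∑ h ∈ H, x h ^ 2 = b) (hT : T ⊆ H) (hTq : #T ≤ q)
    (h : (q - 1 / 10) * b ≤ (∑ h ∈ T, x h) ^ 2) : #T = q := by
  have h1 := sq_sum_le_card_mul hT x
  rw [hbH] at h1
  have h2 : ((q : ℝ) - 1 / 10) ≤ #T := le_of_mul_le_mul_right (h.trans h1) hb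
  refine le_antisymm hTq ?_
  by_contra! hlt
  have : (#T : ℝ) + 1 ≤ q := by exact_mod_cast hlt
  linarith

/-- At most one set of size at most `q` can carry almost the maximal squared sum. -/
theorem eq_of_sq_sum_large {q : ℕ} (hq : 1 ≤ q) {T T₀ H : Finset α} {x : α → ℝ} {b : ℝ}
    (hb : 0 < b) (hbH : ∑ h ∈ H, x h ^ 2 = b) (hT : T ⊆ H) (hTq : #T ≤ q)
    (h : (q - 1 / 10) * b ≤ (∑ h ∈ T, x h) ^ 2) (hT₀ : T₀ ⊆ H) (hTq₀ : #T₀ ≤ q)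
    (h₀ : (q - 1 / 10) * b ≤ (∑ h ∈ T₀, x h) ^ 2) : T = T₀ := by
  have hc := card_eq_of_sq_sum_large hb hbH hT hTq h
  have hc₀ := card_eq_of_sq_sum_large hb hbH hT₀ hTq₀ h₀
  refine Finset.eq_of_subset_of_card_le ?_ (by rw [hc, hc₀])
  intro u hu
  by_contra hu₀
  have hqr : (1 : ℝ) ≤ q := by exact_mod_cast hq
  have h1 : (∑ h ∈ T₀, x h) ^ 2 ≤ q * ∑ h ∈ T₀, x h ^ 2 := by
    rw [← hc₀]; exact sq_sum_le_card_mul_sum_sq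
  have h2 : x u ^ 2 + ∑ h ∈ T₀, x h ^ 2 ≤ b := by
    rw [← hbH, ← Finset.sum_insert (f := fun h => x h ^ 2) hu₀]
    exact Finset.sum_le_sum_of_subset_of_nonneg
      (Finset.insert_subset (hT hu) hT₀) fun _ _ _ => sq_nonneg _
  -- Since `T₀` already carries nearly all of `b`, a vertex `u` outside it is light. Then `T` is
  -- effectively a set of `q - 1` vertices, and its squared sum is at most `(q - 1/5) * b`.
  have h3 : q * x u ^ 2 ≤ b / 10 := by nlinarith
  have h4 := sq_sum_le_card_mul ((Finset.erase_subset u T).trans hT) x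
  rw [hbH, Finset.card_erase_of_mem hu, hc, Nat.cast_sub hq, Nat.cast_one] at h4
  rw [← Finset.add_sum_erase _ _ hu] at h
  set s := ∑ h ∈ T.erase u, x h
  have h5 : 2 * s * x u ≤ s ^ 2 / (2 * q) + 2 * (q * x u ^ 2) := by
    have : s ^ 2 / (2 * q) + 2 * (q * x u ^ 2) - 2 * s * x u =
        (s - 2 * q * x u) ^ 2 / (2 * q) := by
      field_simp; ring
    have h0 : 0 ≤ (s - 2 * q * x u) ^ 2 / (2 * q) := by positivity
    linarith
  have h6 : s ^ 2 / (2 * q) ≤ b / 2 := by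
    rw [div_le_iff₀ (by positivity)]
    nlinarith
  have h7 : x u ^ 2 ≤ b / 10 := by nlinarith [sq_nonneg (x u)]
  nlinarith

/-- Apart from few exceptions, a vertex outside `H` sees at most `q` vertices of `H`, so its sum `σ`
over them satisfies `σ² ≤ q * b`, where `b` is the mass of `H`. A nearly maximal cross term makes
this almost tight for most vertices, and `eq_of_sq_sum_large` says that tightness determines the
neighbourhood in `H`. -/
theorem exists_common_neighbourhood_of_cross_large [Fintype α] {q K M : ℕ} (hq : 1 ≤ q)
    (G : SimpleGraph α) (H : Finset α) (x : α → ℝ) (hx : ∑ v, x v ^ 2 = 1) {n R θ : ℝ}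
    (hn : n = Fintype.card α) (hn0 : 0 < n) (hR : 0 < R) (hRn : R ^ 2 = q * n)
    (hcross : (1 - θ) * R ≤ 2 * ∑ v ∈ Hᶜ, x v * ∑ h ∈ H with G.Adj v h, x h)
    (hH : #H ≤ K) (hM : #{v ∈ Hᶜ | q < #{h ∈ H | G.Adj v h}} ≤ M)
    (hKM : (M : ℝ) * K ≤ θ * n) (hKM' : (K : ℝ) + M ≤ θ * n) (hθ : θ ≤ 1 / 8)
    (hθq : 200 * (θ * q) ≤ 1) :
    ∃ L : Finset α, #L = q ∧ (1 - 101 * (θ * q)) * n ≤ #{v | ∀ l ∈ L, G.Adj v l} := by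
  set T : α → Finset α := fun v => {h ∈ H | G.Adj v h} with hTdef
  set σ : α → ℝ := fun v => ∑ h ∈ T v, x h with hσ
  set a := ∑ v ∈ Hᶜ, x v ^ 2 with ha
  set b := ∑ v ∈ H, x v ^ 2 with hb
  have hab : a + b = 1 := by rw [ha, hb, Finset.sum_compl_add_sum, hx]
  have ha0 : 0 ≤ a := Finset.sum_nonneg fun _ _ => sq_nonneg _
  have hb0 : 0 ≤ b := Finset.sum_nonneg fun _ _ => sq_nonneg _
  have hqr : (1 : ℝ) ≤ q := by exact_mod_cast hq
  have hTH : ∀ v, T v ⊆ H := fun v => Finset.filter_subset _ _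
  have hσle : ∀ v, σ v ^ 2 ≤ #(T v) * b := fun v => sq_sum_le_card_mul (hTH v) x
  have hθ0 : 0 ≤ θ := by
    have : 0 ≤ θ * n := le_trans (by positivity) hKM'
    exact nonneg_of_mul_nonneg_left this hn0
  set Bd : Finset α := {v ∈ Hᶜ | q < #(T v)} with hBd
  set Gd : Finset α := {v ∈ Hᶜ | ¬ q < #(T v)} with hGd
  set S := ∑ v ∈ Hᶜ, σ v ^ 2 with hS
  have hsplit : ∑ v ∈ Bd, σ v ^ 2 + ∑ v ∈ Gd, σ v ^ 2 = S :=
    Finset.sum_filter_add_sum_filter_not _ _ _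
  have hcardsplit : #H + (#Bd + #Gd) = Fintype.card α := by
    rw [hBd, hGd, Finset.card_filter_add_card_filter_not, Finset.card_add_card_compl]
  have hcards : (#H : ℝ) + (#Bd + #Gd) = n := by rw [hn]; exact_mod_cast hcardsplit
  have hHr : (#H : ℝ) ≤ K := by exact_mod_cast hH
  have hMr : (#Bd : ℝ) ≤ M := by exact_mod_cast hM
  have hGn : (#Gd : ℝ) ≤ n := by
    have : (0 : ℝ) ≤ #H := by positivity
    have : (0 : ℝ) ≤ #Bd := by positivity
    linarith
  have hSb : ∑ v ∈ Bd, σ v ^ 2 ≤ θ * n * b := by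
    have h1 : ∑ v ∈ Bd, σ v ^ 2 ≤ ∑ v ∈ Bd, (K : ℝ) * b := by
      refine Finset.sum_le_sum fun v _ => (hσle v).trans ?_
      refine mul_le_mul_of_nonneg_right ?_ hb0
      exact_mod_cast (Finset.card_le_card (hTH v)).trans hH
    rw [Finset.sum_const, nsmul_eq_mul] at h1
    have h2 : (#Bd : ℝ) * (K * b) ≤ M * (K * b) := mul_le_mul_of_nonneg_right hMr (by positivity)
    have h3 : (M : ℝ) * K * b ≤ θ * n * b := mul_le_mul_of_nonneg_right hKM hb0
    linarith
  have hGdle : ∀ v ∈ Gd, σ v ^ 2 ≤ q * b := fun v hv => by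
    rw [hGd, mem_filter, not_lt] at hv
    exact (hσle v).trans (mul_le_mul_of_nonneg_right (by exact_mod_cast hv.2) hb0)
  have hSg : ∑ v ∈ Gd, σ v ^ 2 ≤ n * (q * b) := by
    have h1 := Finset.sum_le_sum hGdle
    rw [Finset.sum_const, nsmul_eq_mul] at h1
    exact h1.trans (mul_le_mul_of_nonneg_right hGn (by positivity))
  -- The parameter is used twice: `s = R` bounds `S` from below, and `s = R / 2` keeps `b` away from
  -- `0`.
  have hamgm : ∀ s : ℝ, 0 < s → 2 * ∑ v ∈ Hᶜ, x v * σ v ≤ s * a + S / s := by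
    intro s hs
    rw [ha, hS, Finset.mul_sum, Finset.mul_sum, Finset.sum_div, ← Finset.sum_add_distrib]
    refine Finset.sum_le_sum fun v _ => ?_
    have : s * x v ^ 2 + σ v ^ 2 / s - 2 * (x v * σ v) = (s * x v - σ v) ^ 2 / s := by
      field_simp; ring
    have h0 : 0 ≤ (s * x v - σ v) ^ 2 / s := by positivity
    linarith
  have hqn : 0 < q * n := by positivity
  have e1 : (b - θ) * (q * n) ≤ S := by
    have h1 := mul_le_mul_of_nonneg_right (hcross.trans (hamgm R hR)) hR.le
    have h2 : (R * a + S / R) * R = a * R ^ 2 + S := by field_simp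
    have h3 : (1 - θ) * R * R = (1 - θ) * R ^ 2 := by ring
    rw [h2, h3, hRn] at h1
    have : a = 1 - b := by linarith
    rw [this] at h1
    linarith
  have hθn : θ * n * b ≤ θ * b * (q * n) := by
    have : θ * b * (1 * n) ≤ θ * b * (q * n) := by gcongr
    linarith
  have e2 : 1 / 5 ≤ b := by
    have h1 := mul_le_mul_of_nonneg_right (hcross.trans (hamgm (R / 2) (by positivity))) hR.le
    have h2 : (R / 2 * a + S / (R / 2)) * R = a * R ^ 2 / 2 + 2 * S := by field_simp
    have h3 : (1 - θ) * R * R = (1 - θ) * R ^ 2 := by ring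
    rw [h2, h3, hRn] at h1
    have h4 : (1 - θ) * (q * n) ≤ ((1 - b) / 2 + 2 * b * (1 + θ)) * (q * n) := by
      have : a = 1 - b := by linarith
      rw [this] at h1
      linarith
    have h5 := le_of_mul_le_mul_right h4 hqn
    have : b * θ ≤ b * (1 / 8) := mul_le_mul_of_nonneg_left hθ hb0
    linarith
  have hb1 : b ≤ 1 := by linarith
  set X : Finset α := {v ∈ Gd | σ v ^ 2 < (q - 1 / 10) * b} with hX
  set Y : Finset α := {v ∈ Gd | ¬ σ v ^ 2 < (q - 1 / 10) * b} with hY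
  have hXY : (#X : ℝ) + #Y = #Gd := by
    rw [hX, hY]; exact_mod_cast Finset.card_filter_add_card_filter_not _
  have hXle : (#X : ℝ) ≤ 100 * (θ * q) * n := by
    -- Each vertex of `X` has deficit more than `b / 10 ≥ 1 / 50`, while the total deficit is at
    -- most `2 * θ * q * n`.
    have h1 : (#X : ℝ) * (1 / 50) ≤ ∑ v ∈ Gd, (q * b - σ v ^ 2) := by
      calc (#X : ℝ) * (1 / 50) = ∑ v ∈ X, (1 / 50 : ℝ) := by
            rw [Finset.sum_const, nsmul_eq_mul]
        _ ≤ ∑ v ∈ X, (q * b - σ v ^ 2) := by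
            refine Finset.sum_le_sum fun v hv => ?_
            rw [hX, mem_filter] at hv
            linarith [hv.2]
        _ ≤ _ := Finset.sum_le_sum_of_subset_of_nonneg (Finset.filter_subset _ _)
            fun v hv _ => sub_nonneg.2 (hGdle v hv)
    rw [Finset.sum_sub_distrib, Finset.sum_const, nsmul_eq_mul] at h1
    have h2 : (#Gd : ℝ) * (q * b) ≤ n * (q * b) :=
      mul_le_mul_of_nonneg_right hGn (by positivity)
    have h3 : θ * b * (q * n) ≤ θ * 1 * (q * n) := by gcongr
    linarith
  have hYle : (1 - 101 * (θ * q)) * n ≤ #Y := by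
    have : θ * 1 * n ≤ θ * q * n := by gcongr
    linarith
  have hYpos : Y.Nonempty := by
    rw [← Finset.card_pos]
    have : (0 : ℝ) < #Y := lt_of_lt_of_le (mul_pos (by linarith) hn0) hYle
    exact_mod_cast this
  obtain ⟨v₀, hv₀⟩ := hYpos
  have hYprop : ∀ v ∈ Y, #(T v) ≤ q ∧ (q - 1 / 10) * b ≤ σ v ^ 2 := by
    intro v hv
    rw [hY, mem_filter, hGd, mem_filter, not_lt, not_lt] at hv
    exact ⟨hv.1.2, hv.2⟩
  have hbpos : 0 < b := by linarith
  refine ⟨T v₀, card_eq_of_sq_sum_large hbpos hb.symm (hTH _) (hYprop _ hv₀).1 (hYprop _ hv₀).2,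
    hYle.trans ?_⟩
  have hsub : Y ⊆ ({v | ∀ l ∈ T v₀, G.Adj v l} : Finset α) := by
    intro v hv
    have := eq_of_sq_sum_large hq hbpos hb.symm (hTH v) (hYprop v hv).1 (hYprop v hv).2
      (hTH v₀) (hYprop _ hv₀).1 (hYprop _ hv₀).2
    rw [mem_filter]
    refine ⟨mem_univ _, fun l hl => ?_⟩
    rw [← this, hTdef, mem_filter] at hl
    exact hl.2
  exact_mod_cast Finset.card_le_card hsub

/-- Each such vertex is a common neighbour of some `(q + 1)`-subset of `H`; a union bound over these
subsets suffices because `H` will have bounded size. -/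
theorem card_filter_many_neighbours_le [Fintype α] {q C : ℕ} (G : SimpleGraph α) (H : Finset α)
    (hcommon : ∀ T : Finset α, #T = q + 1 → #{v | ∀ t ∈ T, G.Adj v t} ≤ C) :
    #{v ∈ Hᶜ | q < #{h ∈ H | G.Adj v h}} ≤ 2 ^ #H * C := by
  have hsub : ({v ∈ Hᶜ | q < #{h ∈ H | G.Adj v h}} : Finset α) ⊆
      (H.powersetCard (q + 1)).biUnion fun T => {v | ∀ t ∈ T, G.Adj v t} := by
    intro v hv
    rw [mem_filter] at hv
    obtain ⟨T, hT, hTc⟩ := Finset.exists_subset_card_eq (Nat.succ_le_of_lt hv.2)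
    rw [mem_biUnion]
    refine ⟨T, mem_powersetCard.2 ⟨hT.trans (Finset.filter_subset _ _), hTc⟩, ?_⟩
    rw [mem_filter]
    exact ⟨mem_univ _, fun t ht => (mem_filter.1 (hT ht)).2⟩
  refine (Finset.card_le_card hsub).trans ?_
  refine (Finset.card_biUnion_le_card_mul _ _ C fun T hT =>
    hcommon T (mem_powersetCard.1 hT).2).trans ?_
  refine Nat.mul_le_mul_right C ?_
  rw [Finset.card_powersetCard]
  exact Nat.choose_le_two_pow _ _

theorem quadForm_split [Fintype α] (G : SimpleGraph α) (H : Finset α) (x : α → ℝ) :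
    ∑ v, x v * nbrSum G x v =
      ∑ u ∈ Hᶜ, ∑ v ∈ Hᶜ, (if G.Adj u v then x u * x v else 0) +
      2 * ∑ v ∈ Hᶜ, x v * ∑ h ∈ H with G.Adj v h, x h +
      ∑ u ∈ H, ∑ v ∈ H, (if G.Adj u v then x u * x v else 0) := by
  have h0 : ∀ v, x v * nbrSum G x v =
      ∑ w ∈ H, (if G.Adj v w then x v * x w else 0) +
        ∑ w ∈ Hᶜ, (if G.Adj v w then x v * x w else 0) := by
    intro v
    rw [Finset.sum_add_sum_compl, nbrSum, Finset.mul_sum]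
    exact Finset.sum_congr rfl fun w _ => by split_ifs <;> simp
  have h1 : ∀ v, x v * ∑ h ∈ H with G.Adj v h, x h =
      ∑ w ∈ H, (if G.Adj v w then x v * x w else 0) := by
    intro v
    rw [Finset.sum_filter, Finset.mul_sum]
    exact Finset.sum_congr rfl fun w _ => by split_ifs <;> simp
  simp only [h0, h1]
  rw [← Finset.sum_add_sum_compl H]
  simp only [Finset.sum_add_distrib]
  have h2 : ∑ u ∈ H, ∑ w ∈ Hᶜ, (if G.Adj u w then x u * x w else 0) =
      ∑ v ∈ Hᶜ, ∑ w ∈ H, (if G.Adj v w then x v * x w else 0) := by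
    rw [Finset.sum_comm]
    simp only [G.adj_comm, mul_comm]
  rw [h2]
  ring

end Structure

/-! ### From a large spectral radius to a large common neighbourhood -/

section Stability

theorem quadForm_le_card {α : Type*} (G : SimpleGraph α) (H : Finset α) (x : α → ℝ) :
    ∑ u ∈ H, ∑ v ∈ H, (if G.Adj u v then x u * x v else 0) ≤ #H * ∑ v ∈ H, x v ^ 2 := by
  have h1 : ∑ u ∈ H, ∑ v ∈ H, (if G.Adj u v then x u * x v else 0) ≤
      ∑ u ∈ H, ∑ v ∈ H, (x u ^ 2 / 2 + x v ^ 2 / 2) := by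
    refine Finset.sum_le_sum fun u _ => Finset.sum_le_sum fun v _ => ?_
    split_ifs
    · nlinarith [sq_nonneg (x u - x v)]
    · positivity
  refine h1.trans (le_of_eq ?_)
  simp only [Finset.sum_add_distrib, Finset.sum_const, nsmul_eq_mul, ← Finset.sum_div,
    ← Finset.mul_sum]
  ring

theorem sum_sq_mul_nbrSum {α : Type*} [Fintype α] {G : SimpleGraph α} {x : α → ℝ} {c : ℝ}
    (hx : ∑ v, x v ^ 2 = 1) (hxe : ∀ v, nbrSum G x v = c * x v) :
    ∑ v, x v * nbrSum G x v = c := by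
  calc ∑ v, x v * nbrSum G x v = c * ∑ v, x v ^ 2 := by
        rw [Finset.mul_sum]
        exact Finset.sum_congr rfl fun v _ => by rw [hxe]; ring
    _ = c := by rw [hx, mul_one]

/-- A degenerate graph in which no `q + 1` vertices have many common neighbours and whose spectral
radius is about `√(qn)` has `q` vertices with almost all vertices as common neighbours. -/
theorem exists_common_neighbourhood (q C : ℕ) (hq : 1 ≤ q) (ε : ℝ) (hε : 0 < ε) :
    ∃ N : ℕ, ∀ (α : Type) [Fintype α] (n : ℕ), Fintype.card α = n → N ≤ n → ∀ G : SimpleGraph α,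
      (∃ f, IsDegenerateOrder G univ C f) →
      (∀ T : Finset α, #T = q + 1 → #{v | ∀ t ∈ T, G.Adj v t} ≤ C) →
      (q : ℝ) * (n - q) ≤ rho G ^ 2 →
      ∃ L : Finset α, #L = q ∧ (1 - ε) * n ≤ #{v | ∀ l ∈ L, G.Adj v l} := by
  have hqr : (1 : ℝ) ≤ q := by exact_mod_cast hq
  obtain ⟨θ, hθ0, hθ, hθq, hθε⟩ : ∃ θ : ℝ, 0 < θ ∧ θ ≤ 1 / 8 ∧ 200 * (θ * q) ≤ 1 ∧
      101 * (θ * q) ≤ ε := by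
    refine ⟨min (1 / 8) (min (1 / (200 * q)) (ε / (101 * q))), by positivity,
      min_le_left _ _, ?_, ?_⟩
    · have h := (min_le_right (1 / 8 : ℝ) _).trans (min_le_left (1 / (200 * q : ℝ)) (ε / (101 * q)))
      rw [le_div_iff₀ (by positivity)] at h
      linarith
    · have h := (min_le_right (1 / 8 : ℝ) _).trans
        (min_le_right (1 / (200 * q : ℝ)) (ε / (101 * q)))
      rw [le_div_iff₀ (by positivity)] at h
      linarith
  -- The error budget is `C + 1` units of `τ` for edges outside `H`, one for edges inside `H` and
  -- one for `rho G` falling short of `R`.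
  set τ : ℝ := θ / (C + 3) with hτ
  have hτ0 : 0 < τ := by positivity
  have hτθ : (C + 3) * τ = θ := by rw [hτ]; field_simp
  have hτ1 : τ ≤ 1 := by
    have h1 : τ ≤ (C + 3) * τ := le_mul_of_one_le_left hτ0.le (by
      have : (0 : ℝ) ≤ C := by positivity
      linarith)
    linarith
  -- The degree sum is at most `2 * C * n`, so at most this many vertices have degree `τ ^ 2 * n` or
  -- more.
  obtain ⟨K, hK⟩ : ∃ K : ℕ, K = ⌊2 * C / τ ^ 2⌋₊ := ⟨_, rfl⟩
  obtain ⟨M, hM⟩ : ∃ M : ℕ, M = 2 ^ K * C := ⟨_, rfl⟩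
  refine ⟨⌈q / τ + K ^ 2 / τ ^ 2 + M * K / θ + (K + M) / θ⌉₊ + 1, fun α _ n hα hn G hord hcom hrho => ?_⟩
  have hnpos : 0 < n := by lia
  have : Nonempty α := Fintype.card_pos_iff.1 (hα ▸ hnpos)
  have hn0 : (0 : ℝ) < n := by exact_mod_cast hnpos
  have hnN : q / τ + K ^ 2 / τ ^ 2 + M * K / θ + (K + M) / θ ≤ (n : ℝ) :=
    (Nat.le_ceil _).trans (by exact_mod_cast (by lia))
  have t1 : 0 ≤ q / τ := by positivity
  have t2 : 0 ≤ (K : ℝ) ^ 2 / τ ^ 2 := by positivity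
  have t3 : 0 ≤ (M : ℝ) * K / θ := by positivity
  have t4 : 0 ≤ ((K : ℝ) + M) / θ := by positivity
  have n1 : q ≤ n * τ := (div_le_iff₀ hτ0).1 (by linarith)
  have n2 : (K : ℝ) ^ 2 ≤ n * τ ^ 2 := (div_le_iff₀ (by positivity)).1 (by linarith)
  have n3 : (M : ℝ) * K ≤ n * θ := (div_le_iff₀ hθ0).1 (by linarith)
  have n4 : (K : ℝ) + M ≤ n * θ := (div_le_iff₀ hθ0).1 (by linarith)
  obtain ⟨f, hf⟩ := hord
  obtain ⟨x, hx0, hx1, hxe⟩ := exists_perron G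
  set r := Real.sqrt n with hr
  have hr0 : 0 < r := Real.sqrt_pos.2 hn0
  have hr2 : r ^ 2 = n := Real.sq_sqrt hn0.le
  set R := Real.sqrt (q * n) with hR
  have hR0 : 0 < R := Real.sqrt_pos.2 (by positivity)
  have hR2 : R ^ 2 = q * n := Real.sq_sqrt (by positivity)
  have hrR : r ≤ R := Real.sqrt_le_sqrt (le_mul_of_one_le_left hn0.le hqr)
  have hKr : (K : ℝ) ≤ τ * r := by
    refine abs_le_of_sq_le_sq' ?_ (by positivity) |>.2
    rw [mul_pow, hr2]; linarith
  have hlam : (1 - τ) * R ≤ rho G := by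
    refine abs_le_of_sq_le_sq' ?_ (rho_nonneg G) |>.2
    refine le_trans ?_ hrho
    rw [mul_pow, hR2]
    have h1 : (1 - τ) ^ 2 ≤ 1 - τ := by
      rw [sq]; exact mul_le_of_le_one_left (by linarith) (by linarith)
    have h2 : (1 - τ) ^ 2 * (q * n) ≤ (1 - τ) * (q * n) :=
      mul_le_mul_of_nonneg_right h1 (by positivity)
    have h3 : (q : ℝ) * q ≤ q * (n * τ) := mul_le_mul_of_nonneg_left n1 (by positivity)
    linarith
  set H : Finset α := {v | τ ^ 2 * n ≤ #{w | G.Adj v w}} with hH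
  have hHK : #H ≤ K := by
    rw [hK]
    apply Nat.le_floor
    rw [le_div_iff₀ (by positivity)]
    have h1 := hf.sum_degree_le
    have h2 : ∑ u ∈ H, τ ^ 2 * n ≤ ∑ u, (#{v | G.Adj u v} : ℝ) :=
      (Finset.sum_le_sum fun u hu => (mem_filter.1 hu).2).trans
        (Finset.sum_le_sum_of_subset_of_nonneg (Finset.subset_univ H)
          fun _ _ _ => by positivity)
    rw [Finset.sum_const, nsmul_eq_mul] at h2
    rw [Finset.card_univ, hα] at h1
    have h3 : (#H * τ ^ 2) * n ≤ 2 * C * n := by linarith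
    exact le_of_mul_le_mul_right h3 hn0
  have hMbound : #{v ∈ Hᶜ | q < #{h ∈ H | G.Adj v h}} ≤ M :=
    hM ▸ (card_filter_many_neighbours_le G H hcom).trans
      (Nat.mul_le_mul_right C (Nat.pow_le_pow_right (by norm_num) hHK))
  have hpart : ∀ S : Finset α, ∑ v ∈ S, x v ^ 2 ≤ 1 := fun S => by
    rw [← hx1]
    exact Finset.sum_le_sum_of_subset_of_nonneg (Finset.subset_univ S) fun _ _ _ => sq_nonneg _
  have hI1 : ∑ u ∈ Hᶜ, ∑ v ∈ Hᶜ, (if G.Adj u v then x u * x v else 0) ≤ (C + 1) * τ * r := by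
    have h1 := (hf.mono (Finset.subset_univ Hᶜ)).sum_adj_le_of_degree x (τ ^ 2 * n) (τ * r)
      (by positivity) (fun v hv => by
        rw [mem_compl, hH, mem_filter] at hv
        have h2 : (#{w | G.Adj v w} : ℝ) < τ ^ 2 * n := by
          by_contra! hc; exact hv ⟨mem_univ _, hc⟩
        refine le_trans ?_ h2.le
        exact_mod_cast Finset.card_le_card
          (Finset.filter_subset_filter _ (Finset.subset_univ _)))
    have h3 : C * (τ * r) + τ ^ 2 * n / (τ * r) = (C + 1) * τ * r := by
      rw [← hr2]; field_simp
    rw [h3] at h1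
    exact h1.trans (mul_le_of_le_one_right (by positivity) (hpart _))
  have hI3 : ∑ u ∈ H, ∑ v ∈ H, (if G.Adj u v then x u * x v else 0) ≤ K :=
    (quadForm_le_card G H x).trans ((mul_le_of_le_one_right (by positivity) (hpart _)).trans
      (by exact_mod_cast hHK))
  have hquad := quadForm_split G H x
  rw [sum_sq_mul_nbrSum hx1 hxe] at hquad
  obtain ⟨L, hL, hLn⟩ := exists_common_neighbourhood_of_cross_large (K := K) (M := M) (n := n)
    (R := R) (θ := θ) hq G H x hx1 (by rw [hα]) hn0 hR0 hR2 (by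
      have h1 : (C + 1) * τ * r ≤ (C + 1) * τ * R := by gcongr
      have h2 : τ * r ≤ τ * R := by gcongr
      rw [← hτθ]
      linarith) hHK hMbound (by linarith) (by linarith) hθ hθq
  refine ⟨L, hL, le_trans ?_ hLn⟩
  exact mul_le_mul_of_nonneg_right (by linarith) hn0.le

end Stability

/-! ### Building copies of `F` from common neighbourhoods -/

section Embedding

variable {V α : Type*} [Fintype V]

/-- If `S` covers the edges of `F`, then a copy of `F[S]` whose vertices have enough common
neighbours extends to a copy of `F`. -/
theorem isContained_of_cover {F : SimpleGraph V} {G : SimpleGraph α} (S : Set V)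
    (hS : F.IsVertexCover S) (g : V → α) (hg : Set.InjOn g S)
    (hadj : ∀ u ∈ S, ∀ v ∈ S, F.Adj u v → G.Adj (g u) (g v)) (W : Finset α)
    (hW : ∀ u ∈ S, ∀ w ∈ W, G.Adj (g u) w) (hcard : Fintype.card V ≤ #W) : F ⊑ G := by
  obtain ⟨e⟩ : Nonempty (V ↪ W) := by
    apply Function.Embedding.nonempty_of_card_le; simpa using hcard
  refine isContained_of_injective (fun v => if v ∈ S then g v else e v) ?_ ?_
  · intro u v huv
    by_cases hu : u ∈ S <;> by_cases hv : v ∈ S <;> simp only [hu, hv, if_true, if_false] at huv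
    · exact hg hu hv huv
    · have := hW u hu (e v) (e v).2
      rw [huv] at this
      exact absurd rfl this.ne
    · have := hW v hv (e u) (e u).2
      rw [huv] at this
      exact absurd rfl this.ne
    · exact e.injective (Subtype.ext huv)
  · intro u v huv
    by_cases hu : u ∈ S <;> by_cases hv : v ∈ S <;> simp only [hu, hv, if_true, if_false]
    · exact hadj u hu v hv huv
    · exact hW u hu _ (e v).2
    · exact (hW v hv _ (e u).2).symm
    · exact absurd (hS huv) (by simp [hu, hv])

theorem isVertexCover_left {U : Type*} {F : SimpleGraph U} {A B : Finset U}
    (hbip : F.IsBipartiteWith (A : Set U) (B : Set U)) : F.IsVertexCover (A : Set U) := by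
  intro u v huv
  rcases hbip.mem_of_adj huv with h | h
  · exact Or.inl h.1
  · exact Or.inr h.2

/-- Otherwise `A` could be placed on `T` and the remaining vertices of `F` among the common
neighbours. Nothing is required inside `T`, because `A` is independent. -/
theorem card_common_neighbours_le [Fintype α] {F : SimpleGraph V} {G : SimpleGraph α}
    {A B : Finset V} (hbip : F.IsBipartiteWith (A : Set V) (B : Set V)) (hfree : F.Free G)
    {T : Finset α} (hT : #T = #A) : #{v | ∀ t ∈ T, G.Adj v t} ≤ Fintype.card V := by
  by_contra! hlt
  have e : A ≃ T := Fintype.equivOfCardEq (by simp [hT])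
  rcases T.eq_empty_or_nonempty with hT0 | ⟨t₀, ht₀⟩
  · have hA : A = ∅ := by rw [← Finset.card_eq_zero, ← hT, hT0, Finset.card_empty]
    have hα : Nonempty α := by
      obtain ⟨v, -⟩ := Finset.card_pos.1 (lt_of_le_of_lt (Nat.zero_le _) hlt)
      exact ⟨v⟩
    exact hfree (isContained_of_cover (A : Set V) (isVertexCover_left hbip)
      (fun _ => Classical.arbitrary α) (by simp [hA]) (by simp [hA]) _ (by simp [hA]) hlt.le)
  · refine hfree (isContained_of_cover (A : Set V) (isVertexCover_left hbip)
      (fun v => if h : v ∈ A then e ⟨v, h⟩ else t₀) ?_ ?_ _ ?_ hlt.le)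
    · intro u hu v hv huv
      rw [mem_coe] at hu hv
      simp only [hu, hv, dite_true] at huv
      simpa using e.injective (Subtype.ext huv)
    · intro u hu v hv huv
      rcases hbip.mem_of_adj huv with h | h
      · exact absurd h.2 (Set.disjoint_left.1 hbip.disjoint hv)
      · exact absurd h.1 (Set.disjoint_left.1 hbip.disjoint hu)
    · intro u hu w hw
      rw [mem_coe] at hu
      simp only [hu, dite_true]
      exact ((mem_filter.1 hw).2 _ (e ⟨u, hu⟩).2).symm

/-- If `A` contains a leaf, a graph containing `K_{q,m}` with `m` large and one more edge at the
large side contains `F`. -/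
theorem isContained_of_leaf {F : SimpleGraph V} {G : SimpleGraph α} {A B : Finset V}
    (hbip : F.IsBipartiteWith (A : Set V) (B : Set V)) (hunion : A ∪ B = univ) {a b : V}
    (ha : a ∈ A) (hab : F.Adj a b) (hleaf : ∀ v, F.Adj a v → v = b) {L W : Finset α}
    (hL : #L + 1 = #A) (hLW : ∀ l ∈ L, ∀ w ∈ W, G.Adj l w) (hW : Fintype.card V + 2 ≤ #W)
    {w r : α} (hw : w ∈ W) (hr : r ∉ L) (hwr : G.Adj w r) : F ⊑ G := by
  have hAB : ∀ v, v ∉ A → v ∈ B := fun v hv => by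
    have : v ∈ A ∪ B := by rw [hunion]; exact mem_univ v
    exact (mem_union.1 this).resolve_left hv
  have hbA : b ∉ A := fun h => by
    rcases hbip.mem_of_adj hab with h' | h'
    · exact Set.disjoint_left.1 hbip.disjoint h h'.2
    · exact Set.disjoint_left.1 hbip.disjoint ha h'.1
  have e : (A.erase a) ≃ L := Fintype.equivOfCardEq (by
    simp only [Fintype.card_coe]; rw [Finset.card_erase_of_mem ha]; lia)
  -- The vertices `w` and `r` are reserved for `b` and `a`; this is what the `+ 2` in `hW` pays for.
  obtain ⟨e'⟩ : Nonempty (V ↪ ((W.erase w).erase r : Finset α)) := by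
    apply Function.Embedding.nonempty_of_card_le
    rw [Fintype.card_coe]
    have h1 := Finset.card_erase_of_mem hw
    have h2 := (W.erase w).pred_card_le_card_erase (a := r)
    lia
  have he' : ∀ v, (e' v : α) ≠ r ∧ (e' v : α) ≠ w ∧ (e' v : α) ∈ W := fun v => by
    have h1 := mem_erase.1 (e' v).2
    have h2 := mem_erase.1 h1.2
    exact ⟨h1.1, h2.1, h2.2⟩
  have hdisj : ∀ l ∈ L, l ∉ W := fun l hl hlW => (hLW l hl l hlW).ne rfl
  set f : V → α := fun v => if h : v ∈ A.erase a then e ⟨v, h⟩ else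
    if v = a then r else if v = b then w else e' v with hf
  have f1 : ∀ v (h : v ∈ A.erase a), f v = e ⟨v, h⟩ := fun v h => by simp only [hf, h, dite_true]
  have f2 : f a = r := by simp [hf]
  have f3 : f b = w := by
    have : b ≠ a := hab.ne'
    simp [hf, hbA, this]
  have f4 : ∀ v, v ∉ A → v ≠ b → f v = e' v := fun v hv hvb => by
    have : v ≠ a := fun h => hv (h ▸ ha)
    simp [hf, hv, hvb, this]
  have fL : ∀ v, v ∈ A → v ≠ a → f v ∈ L := fun v hv hva => by
    rw [f1 v (mem_erase.2 ⟨hva, hv⟩)]; exact (e _).2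
  have fW : ∀ v, v ∉ A → f v ∈ W ∧ f v ≠ r := fun v hv => by
    by_cases hvb : v = b
    · rw [hvb, f3]; exact ⟨hw, hwr.ne⟩
    · rw [f4 v hv hvb]; exact ⟨(he' v).2.2, (he' v).1⟩
  refine isContained_of_injective f ?_ ?_
  · have key : ∀ u v, f u = f v → u ∈ A → v ∉ A → False := by
      intro u v huv hu hv
      by_cases hua : u = a
      · rw [hua, f2] at huv
        exact (fW v hv).2 huv.symm
      · exact hdisj _ (fL u hu hua) (huv ▸ (fW v hv).1)
    intro u v huv
    by_cases hu : u ∈ A <;> by_cases hv : v ∈ A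
    · by_cases hua : u = a <;> by_cases hva : v = a
      · rw [hua, hva]
      · rw [hua, f2] at huv
        exact absurd (huv ▸ fL v hv hva) hr
      · rw [hva, f2] at huv
        exact absurd (huv ▸ fL u hu hua) hr
      · rw [f1 u (mem_erase.2 ⟨hua, hu⟩), f1 v (mem_erase.2 ⟨hva, hv⟩)] at huv
        simpa using e.injective (Subtype.ext huv)
    · exact (key u v huv hu hv).elim
    · exact (key v u huv.symm hv hu).elim
    · by_cases hub : u = b <;> by_cases hvb : v = b
      · rw [hub, hvb]
      · rw [hub, f3, f4 v hv hvb] at huv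
        exact absurd huv.symm (he' v).2.1
      · rw [hvb, f3, f4 u hu hub] at huv
        exact absurd huv (he' u).2.1
      · rw [f4 u hu hub, f4 v hv hvb] at huv
        exact e'.injective (Subtype.ext huv)
  · have key : ∀ u v, F.Adj u v → u ∈ A → v ∉ A → G.Adj (f u) (f v) := by
      intro u v huv hu hv
      by_cases hua : u = a
      · have : v = b := hleaf v (hua ▸ huv)
        rw [hua, this, f2, f3]
        exact hwr.symm
      · exact hLW _ (fL u hu hua) _ (fW v hv).1
    intro u v huv
    rcases hbip.mem_of_adj huv with h | h
    · exact key u v huv h.1 (fun h' => Set.disjoint_left.1 hbip.disjoint h' h.2)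
    · exact (key v u huv.symm h.2 (fun h' => Set.disjoint_left.1 hbip.disjoint h' h.1)).symm

end Embedding

/-! ### Rewiring the exceptional vertices -/

section Extremal

variable {α : Type*}

/-- The graph obtained from `G` by joining `L` completely to its complement and deleting all edges
outside `L`. -/
def joinOutside (G : SimpleGraph α) (L : Finset α) : SimpleGraph α where
  Adj u v := (u ∈ L ∧ v ∈ L ∧ G.Adj u v) ∨ (u ∈ L ∧ v ∉ L) ∨ (u ∉ L ∧ v ∈ L)
  symm := ⟨fun u v h => by
    rcases h with h | h | h
    · exact Or.inl ⟨h.2.1, h.1, h.2.2.symm⟩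
    · exact Or.inr (Or.inr ⟨h.2, h.1⟩)
    · exact Or.inr (Or.inl ⟨h.2, h.1⟩)⟩
  loopless := ⟨fun u h => by
    rcases h with h | h | h
    · exact h.2.2.ne rfl
    · exact h.2 h.1
    · exact h.1 h.2⟩

/-- The part of a copy of `F` inside `L` comes from a vertex cover, since no edges remain outside
`L`. Its edges already lie in `G`, where the common neighbours `W` complete it to a copy of `F`. -/
theorem free_joinOutside {V : Type*} [Fintype V] {F : SimpleGraph V} {G : SimpleGraph α}
    (hfree : F.Free G) {L W : Finset α} (hLW : ∀ l ∈ L, ∀ w ∈ W, G.Adj l w)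
    (hW : Fintype.card V ≤ #W) : F.Free (joinOutside G L) := by
  rintro ⟨f⟩
  have hadj : ∀ u v, F.Adj u v → (joinOutside G L).Adj (f u) (f v) := fun u v huv =>
    f.toHom.map_adj huv
  refine hfree (isContained_of_cover {v | f v ∈ L} ?_ f f.injective.injOn ?_ W ?_ hW)
  · intro u v huv
    rcases hadj u v huv with h | h | h
    · exact Or.inl h.1
    · exact Or.inl h.1
    · exact Or.inr h.2
  · intro u hu v hv huv
    rcases hadj u v huv with h | h | h
    · exact h.2.2
    · exact absurd hv h.2
    · exact absurd hu h.1
  · intro u hu w hw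
    exact hLW _ hu w hw

theorem nbrSum_joinOutside_of_notMem [Fintype α] (G : SimpleGraph α) {L : Finset α} (x : α → ℝ)
    {v : α} (hv : v ∉ L) : nbrSum (joinOutside G L) x v = ∑ l ∈ L, x l := by
  unfold nbrSum
  rw [← Finset.sum_filter]
  refine Finset.sum_congr ?_ fun _ _ => rfl
  ext w
  simp [joinOutside, hv]

theorem nbrSum_le_joinOutside_of_mem [Fintype α] (G : SimpleGraph α) {L : Finset α} {x : α → ℝ}
    (hx : ∀ v, 0 ≤ x v) {v : α} (hv : v ∈ L) :
    nbrSum G x v ≤ nbrSum (joinOutside G L) x v := by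
  refine Finset.sum_le_sum fun w _ => ?_
  by_cases hvw : G.Adj v w
  · have : (joinOutside G L).Adj v w := by
      by_cases hw : w ∈ L
      · exact Or.inl ⟨hv, hw, hvw⟩
      · exact Or.inr (Or.inl ⟨hv, hw⟩)
    simp [hvw, this]
  · simp only [hvw, if_false]
    split_ifs <;> simp [hx]

/-- A crude bound, needed only to make `rho G` negligible against the number of vertices. -/
theorem rho_le_of_isDegenerateOrder [Fintype α] [Nonempty α] {G : SimpleGraph α} {C : ℕ}
    {f : α → ℕ} (hf : IsDegenerateOrder G univ C f) :
    rho G ≤ (C + 1) * Real.sqrt (Fintype.card α) := by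
  obtain ⟨x, hx0, hx1, hxe⟩ := exists_perron G
  have hn : (0 : ℝ) < Fintype.card α := by exact_mod_cast Fintype.card_pos
  have h1 := hf.sum_adj_le_of_degree x (Fintype.card α) (Real.sqrt (Fintype.card α))
    (Real.sqrt_pos.2 hn) (fun v _ => by exact_mod_cast Finset.card_le_univ _)
  rw [hx1, mul_one, Real.div_sqrt] at h1
  have h2 : ∑ u, ∑ v, (if G.Adj u v then x u * x v else 0) = rho G := by
    rw [← sum_sq_mul_nbrSum hx1 hxe]
    refine Finset.sum_congr rfl fun u _ => ?_
    rw [nbrSum, Finset.mul_sum]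
    exact Finset.sum_congr rfl fun v _ => by split_ifs <;> simp
  rw [h2] at h1
  linarith

/-- If almost all vertices have neighbourhood exactly `L` and the spectral radius cannot be
increased by passing to `joinOutside G L`, then no vertex outside `L` misses a vertex of `L`. -/
theorem eq_empty_of_rho_joinOutside_le [Fintype α] [Nonempty α] {G : SimpleGraph α} {C : ℕ}
    {f : α → ℕ} (hf : IsDegenerateOrder G univ C f) {L W R : Finset α}
    (hW : ∀ v, v ∈ W ↔ ∀ l ∈ L, G.Adj v l) (hR : R = (L ∪ W)ᶜ)
    (hWL : ∀ w ∈ W, ∀ v, G.Adj w v → v ∈ L) (hmax : rho (joinOutside G L) ≤ rho G)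
    (hpos : 0 < rho G) (hR1 : 4 * C * (#R : ℝ) ≤ rho G ^ 2)
    (hR2 : 4 * C * (rho G + #R) < #W) : R = ∅ := by
  by_contra hne
  have hne' : R.Nonempty := Finset.nonempty_iff_ne_empty.2 hne
  obtain ⟨x, hx0, hx1, hxe⟩ := exists_perron G
  obtain ⟨r₀, hr₀, hmaxr⟩ := Finset.exists_max_image R x hne'
  set lam := rho G with hlam
  set m := x r₀ with hm
  set s := ∑ l ∈ L, x l with hs
  have hs0 : 0 ≤ s := Finset.sum_nonneg fun _ _ => hx0 _
  have hWmem : ∀ w ∈ W, ∀ l ∈ L, G.Adj w l := fun w hw => (hW w).1 hw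
  have hRmem : ∀ r ∈ R, r ∉ L ∧ r ∉ W := fun r hr => by
    rw [hR, mem_compl, mem_union, not_or] at hr; exact hr
  have hcase : ∀ v, v ∉ L → v ∉ W → v ∈ R := fun v h1 h2 => by
    rw [hR, mem_compl, mem_union, not_or]; exact ⟨h1, h2⟩
  have hRmiss : ∀ r ∈ R, ∃ l ∈ L, ¬ G.Adj r l := fun r hr => by
    have := (hRmem r hr).2
    rw [hW] at this
    simpa using this
  have hWn : ∀ w ∈ W, nbrSum G x w = s := by
    intro w hw
    unfold nbrSum
    rw [← Finset.sum_filter]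
    refine Finset.sum_congr ?_ fun _ _ => rfl
    ext v
    simp only [mem_filter, mem_univ, true_and]
    exact ⟨hWL w hw v, fun hv => hWmem w hw v hv⟩
  have hWx : ∀ w ∈ W, lam * x w = s := fun w hw => by rw [← hxe, hWn w hw]
  have hRn : ∀ r ∈ R, nbrSum G x r = ∑ l ∈ L, (if G.Adj r l then x l else 0) +
      ∑ r' ∈ R, (if G.Adj r r' then x r' else 0) := by
    intro r hr
    have hdisj : Disjoint L R := Finset.disjoint_right.2 fun v hv => (hRmem v hv).1
    rw [← Finset.sum_union hdisj, nbrSum]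
    refine (Finset.sum_subset (Finset.subset_univ _) fun v _ hv => ?_).symm
    rw [mem_union, not_or] at hv
    have hvW : v ∈ W := by
      by_contra h
      exact hv.2 (hcase v hv.1 h)
    have : ¬ G.Adj r v := fun h => (hRmem r hr).1 (hWL v hvW r h.symm)
    simp [this]
  have hLle : ∀ r, ∑ l ∈ L, (if G.Adj r l then x l else 0) ≤ s := fun r =>
    Finset.sum_le_sum fun l _ => by split_ifs <;> simp [hx0]
  have hLx : ∀ l ∈ L, #W * s ≤ lam ^ 2 * x l := by
    intro l hl
    have h1 : ∑ w ∈ W, x w ≤ nbrSum G x l := by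
      rw [nbrSum, ← Finset.sum_filter]
      refine Finset.sum_le_sum_of_subset_of_nonneg (fun w hw => ?_) fun _ _ _ => hx0 _
      rw [mem_filter]
      exact ⟨mem_univ _, (hWmem w hw l hl).symm⟩
    have h2 : lam * ∑ w ∈ W, x w = #W * s := by
      rw [Finset.mul_sum, Finset.sum_congr rfl hWx, Finset.sum_const, nsmul_eq_mul]
    have h3 := mul_le_mul_of_nonneg_left h1 hpos.le
    rw [h2, hxe] at h3
    linarith
  have hm0 : 0 ≤ m := hx0 _
  have hfR := hf.mono (Finset.subset_univ R)
  have hRbound : ∀ r ∈ R, lam * x r ≤ s + #{r' ∈ R | G.Adj r r'} * m := by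
    intro r hr
    rw [← hxe, hRn r hr]
    refine add_le_add (hLle r) ?_
    rw [← Finset.sum_filter, ← nsmul_eq_mul, ← Finset.sum_const]
    exact Finset.sum_le_sum fun r' hr' => hmaxr r' (mem_filter.1 hr').1
  -- The eigenvalue equation is applied twice inside `R`; degeneracy bounds the degree sum there,
  -- and `hR1` absorbs the resulting term in `m` into half of the left side.
  have hmbound : lam ^ 2 * m ≤ 2 * (lam + #R) * s := by
    have h1 : lam * m ≤ s + ∑ r' ∈ R, (if G.Adj r₀ r' then x r' else 0) := by
      rw [hm, ← hxe, hRn r₀ hr₀]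
      exact add_le_add (hLle r₀) le_rfl
    have h2 : lam * ∑ r' ∈ R, (if G.Adj r₀ r' then x r' else 0) ≤
        ∑ r' ∈ R, (s + #{r'' ∈ R | G.Adj r' r''} * m) := by
      rw [Finset.mul_sum]
      refine Finset.sum_le_sum fun r' hr' => ?_
      split_ifs
      · exact hRbound r' hr'
      · rw [mul_zero]; positivity
    rw [Finset.sum_add_distrib, Finset.sum_const, nsmul_eq_mul, ← Finset.sum_mul] at h2
    have h3 := mul_le_mul_of_nonneg_right hfR.sum_degree_le hm0
    have h4 := mul_le_mul_of_nonneg_left h1 hpos.le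
    have h5 := mul_le_mul_of_nonneg_right hR1 hm0
    linarith
  have hspos : 0 < s := by
    refine lt_of_le_of_ne hs0 fun h => ?_
    rw [← h, mul_zero] at hmbound
    have hm' : m = 0 := by
      refine le_antisymm ?_ hm0
      by_contra! hc
      have : 0 < lam ^ 2 * m := by positivity
      linarith
    have hall : ∀ v, x v = 0 := by
      intro v
      by_cases hvL : v ∈ L
      · exact (Finset.sum_eq_zero_iff_of_nonneg fun _ _ => hx0 _).1 h.symm v hvL
      · by_cases hvW : v ∈ W
        · have := hWx v hvW
          rw [← h] at this
          exact (mul_eq_zero.1 this).resolve_left hpos.ne'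
        · exact le_antisymm (hm' ▸ hmaxr v (hcase v hvL hvW)) (hx0 v)
    simp [hall] at hx1
  set μ := #W * s / lam ^ 2 with hμ
  have hμL : ∀ l ∈ L, μ ≤ x l := fun l hl => by
    rw [hμ, div_le_iff₀ (by positivity)]
    linarith [hLx l hl]
  have hgap : 2 * (C * m) < μ := by
    rw [hμ, lt_div_iff₀ (by positivity)]
    have h1 := mul_lt_mul_of_pos_right hR2 hspos
    have h2 := mul_le_mul_of_nonneg_left hmbound (by positivity : (0 : ℝ) ≤ 2 * C)
    linarith
  -- A rewired vertex gains a missing neighbour in `L`, of weight at least `μ`. The lost edges all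
  -- lie inside `R` and cost at most `2 * (C * m)` per unit of weight, by degeneracy.
  have hdiff : ∑ r ∈ R, x r * (μ - 2 * (C * m)) ≤
      ∑ v, (x v * nbrSum (joinOutside G L) x v - x v * nbrSum G x v) := by
    have h1 : ∑ v ∈ R, (x v * nbrSum (joinOutside G L) x v - x v * nbrSum G x v) ≤
        ∑ v, (x v * nbrSum (joinOutside G L) x v - x v * nbrSum G x v) := by
      refine Finset.sum_le_sum_of_subset_of_nonneg (Finset.subset_univ R) fun v _ hv => ?_
      rw [← mul_sub]
      refine mul_nonneg (hx0 v) (sub_nonneg.2 ?_)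
      by_cases hvL : v ∈ L
      · exact nbrSum_le_joinOutside_of_mem G hx0 hvL
      · have hvW : v ∈ W := by
          by_contra h
          exact hv (hcase v hvL h)
        rw [hWn v hvW, nbrSum_joinOutside_of_notMem G x hvL]
    refine le_trans ?_ h1
    have h2 : ∀ r ∈ R, x r * μ - ∑ r' ∈ R, (if G.Adj r r' then x r * x r' else 0) ≤
        x r * nbrSum (joinOutside G L) x r - x r * nbrSum G x r := by
      intro r hr
      rw [nbrSum_joinOutside_of_notMem G x (hRmem r hr).1, hRn r hr]
      obtain ⟨l, hl, hrl⟩ := hRmiss r hr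
      have h3 : ∑ l ∈ L, (if G.Adj r l then x l else 0) + x l ≤ s := by
        rw [hs, ← Finset.add_sum_erase _ _ hl, ← Finset.add_sum_erase _ x hl]
        simp only [hrl, if_false, zero_add]
        rw [add_comm]
        refine add_le_add le_rfl (Finset.sum_le_sum fun l _ => ?_)
        split_ifs <;> simp [hx0]
      have h4 : ∑ r' ∈ R, (if G.Adj r r' then x r * x r' else 0) =
          x r * ∑ r' ∈ R, (if G.Adj r r' then x r' else 0) := by
        rw [Finset.mul_sum]
        exact Finset.sum_congr rfl fun v _ => by split_ifs <;> simp
      rw [h4]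
      have h5 := hμL l hl
      have h6 := mul_le_mul_of_nonneg_left (add_le_add h5 h3) (hx0 r)
      linarith
    refine le_trans ?_ (Finset.sum_le_sum h2)
    rw [Finset.sum_sub_distrib, ← Finset.sum_mul, ← Finset.sum_mul]
    have h7 := hfR.sum_adj_le_of_le x (fun v _ => hx0 v) m (fun v hv => hmaxr v hv)
    linarith
  rw [Finset.sum_sub_distrib, sum_sq_mul_nbrSum hx1 hxe, ← Finset.sum_mul] at hdiff
  have hRsum : 0 ≤ ∑ r ∈ R, x r := Finset.sum_nonneg fun _ _ => hx0 _
  have hle := quadForm_le_rho (joinOutside G L) x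
  rw [hx1, mul_one] at hle
  have hnn : 0 ≤ (∑ r ∈ R, x r) * (μ - 2 * (C * m)) := mul_nonneg hRsum (by linarith)
  -- Maximality leaves only equality, so `x` is also an eigenvector of the rewired graph. The gain
  -- must vanish, hence `x r₀ = 0`, while the equation at `r₀` would give `s = 0`.
  have heig := nbrSum_eq_of_quadForm_eq (joinOutside G L) x (by rw [hx1, mul_one]; linarith) r₀
  rw [nbrSum_joinOutside_of_notMem G x (hRmem r₀ hr₀).1] at heig
  have hz : ∑ r ∈ R, x r = 0 := by
    have : (∑ r ∈ R, x r) * (μ - 2 * (C * m)) = 0 := le_antisymm (by linarith) hnn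
    exact (mul_eq_zero.1 this).resolve_right (by linarith)
  have hz0 := (Finset.sum_eq_zero_iff_of_nonneg fun _ _ => hx0 _).1 hz r₀ hr₀
  rw [hz0, mul_zero] at heig
  exact hspos.ne' heig

/-- If `A` contains a leaf, then an `F`-free graph of maximum spectral radius has `q = |A| - 1`
vertices such that all other vertices have exactly these `q` vertices as neighbours. -/
theorem exists_adj_iff_mem_of_rho_max {V : Type*} [Fintype V] {F : SimpleGraph V} (hF : F.IsTree)
    {A B : Finset V} (hbip : F.IsBipartiteWith (A : Set V) (B : Set V))
    (hunion : A ∪ B = univ) {q : ℕ} (hA : #A = q + 1) (hq : 1 ≤ q) {a b : V}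
    (ha : a ∈ A) (hab : F.Adj a b) (hleaf : ∀ v, F.Adj a v → v = b) :
    ∃ N : ℕ, ∀ (α : Type) [Fintype α] (n : ℕ), Fintype.card α = n → N ≤ n → ∀ G : SimpleGraph α,
      F.Free G → (∀ G' : SimpleGraph α, F.Free G' → rho G' ≤ rho G) →
      (q : ℝ) * (n - q) ≤ rho G ^ 2 →
      ∃ L : Finset α, #L = q ∧ ∀ v ∉ L, ∀ w, G.Adj v w ↔ w ∈ L := by
  set C := Fintype.card V with hC
  have hc0 : (0 : ℝ) ≤ C := by positivity
  set ε : ℝ := 1 / (8 * (C + 1)) with hε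
  have hε0 : 0 < ε := by positivity
  have hεC : 8 * (C * ε) + 8 * ε = 1 := by rw [hε]; field_simp
  have hCε : 0 ≤ C * ε := by positivity
  obtain ⟨N, hN⟩ := exists_common_neighbourhood q C hq ε hε0
  refine ⟨N + (12 * (C + 1) ^ 2) ^ 2 + 2 * q + 2 * (C + 2), fun α _ n hα hn G hfree hmax hrho => ?_⟩
  have hnpos : 0 < n := by lia
  have hn0 : (0 : ℝ) < n := by exact_mod_cast hnpos
  have : Nonempty α := Fintype.card_pos_iff.1 (hα ▸ hnpos)
  obtain ⟨f, hf⟩ := exists_isDegenerateOrder hF hfree (univ : Finset α)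
  obtain ⟨L, hL, hLn⟩ := hN α n hα (by lia) G ⟨f, hf⟩
    (fun T hT => card_common_neighbours_le hbip hfree (by rw [hT, hA])) hrho
  set W : Finset α := {v | ∀ l ∈ L, G.Adj v l} with hW
  have hWmem : ∀ v, v ∈ W ↔ ∀ l ∈ L, G.Adj v l := fun v => by simp [hW]
  have hLW : ∀ l ∈ L, ∀ w ∈ W, G.Adj l w := fun l hl w hw => ((hWmem w).1 hw l hl).symm
  have hWC : C + 2 ≤ #W := by
    have h1 : (2 * (C + 2) : ℝ) ≤ n := by exact_mod_cast (by lia : 2 * (C + 2) ≤ n)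
    have h2 : ε * n ≤ 1 / 2 * n := mul_le_mul_of_nonneg_right (by linarith) hn0.le
    have h3 : ((C + 2 : ℕ) : ℝ) ≤ #W := by push_cast; linarith
    exact_mod_cast h3
  have hWL : ∀ w ∈ W, ∀ v, G.Adj w v → v ∈ L := by
    intro w hw v hwv
    by_contra hv
    exact hfree (isContained_of_leaf hbip hunion ha hab hleaf (by rw [hL, hA]) hLW hWC hw hv hwv)
  have hdisj : Disjoint L W := Finset.disjoint_left.2 fun l hl hlW => (hLW l hl l hlW).ne rfl
  have hRcard : (#(L ∪ W)ᶜ : ℝ) ≤ ε * n := by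
    have h1 : #(L ∪ W) + #(L ∪ W)ᶜ = n := by rw [Finset.card_add_card_compl, hα]
    rw [Finset.card_union_of_disjoint hdisj] at h1
    have h2 : (#L : ℝ) + #W + #(L ∪ W)ᶜ = n := by exact_mod_cast h1
    have h3 : (0 : ℝ) ≤ #L := by positivity
    linarith
  have hsq : (n : ℝ) / 2 ≤ rho G ^ 2 := by
    refine le_trans ?_ hrho
    have h1 : (2 * q : ℝ) ≤ n := by exact_mod_cast (by lia : 2 * q ≤ n)
    have h2 : (1 : ℝ) ≤ q := by exact_mod_cast hq
    have h3 : (n - q : ℝ) ≤ q * (n - q) := le_mul_of_one_le_left (by linarith) h2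
    linarith
  have hpos : 0 < rho G := by
    refine lt_of_le_of_ne (rho_nonneg G) fun h => ?_
    rw [← h] at hsq
    norm_num at hsq
    linarith
  have hlam : 3 * (C * rho G) ≤ n / 4 := by
    have h1 := rho_le_of_isDegenerateOrder hf
    rw [hα] at h1
    set r := Real.sqrt n with hr
    have hr2 : r * r = n := Real.mul_self_sqrt hn0.le
    have hr0 : 0 ≤ r := Real.sqrt_nonneg _
    have h2 : 12 * ((C : ℝ) + 1) ^ 2 ≤ r := by
      apply Real.le_sqrt_of_sq_le
      exact_mod_cast (by lia : (12 * (C + 1) ^ 2) ^ 2 ≤ n)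
    have h3 : 12 * ((C : ℝ) + 1) ^ 2 * r ≤ n := by
      rw [← hr2]; exact mul_le_mul_of_nonneg_right h2 hr0
    have h4 : (C : ℝ) * rho G ≤ (C + 1) * ((C + 1) * r) :=
      mul_le_mul (by linarith) h1 hpos.le (by positivity)
    nlinarith
  have hempty := eq_empty_of_rho_joinOutside_le hf hWmem rfl hWL
    (hmax _ (free_joinOutside hfree hLW (by lia))) hpos
    (by
      have h1 : 4 * C * (#(L ∪ W)ᶜ : ℝ) ≤ 4 * C * (ε * n) := by gcongr
      have h2 : 8 * (C * ε) * n ≤ 1 * n := mul_le_mul_of_nonneg_right (by linarith) hn0.le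
      linarith)
    (by
      have h1 : C * (#(L ∪ W)ᶜ : ℝ) ≤ C * (ε * n) := by gcongr
      have h2 : (8 * (C * ε) + 8 * ε) * n = n := by rw [hεC, one_mul]
      have h3 : 0 < ε * n := by positivity
      have h4 : 0 ≤ C * ε * n := by positivity
      linarith)
  refine ⟨L, hL, fun v hv w => ?_⟩
  have hvW : v ∈ W := by
    by_contra h
    have : v ∈ (L ∪ W)ᶜ := by rw [mem_compl, mem_union, not_or]; exact ⟨hv, h⟩
    rw [hempty] at this
    simp at this
  exact ⟨hWL v hvW w, fun hw => (hWmem v).1 hvW w hw⟩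

end Extremal

/-! ### Joins with an independent set and the covering family -/

section Join

variable {V W : Type*}

@[simp] theorem join_adj_inl_inl (G : SimpleGraph V) (H : SimpleGraph W) (u v : V) :
    (join G H).Adj (Sum.inl u) (Sum.inl v) ↔ G.Adj u v := by simp [join]

@[simp] theorem join_adj_inr_inr (G : SimpleGraph V) (H : SimpleGraph W) (u v : W) :
    (join G H).Adj (Sum.inr u) (Sum.inr v) ↔ H.Adj u v := by simp [join]

@[simp] theorem join_adj_inl_inr (G : SimpleGraph V) (H : SimpleGraph W) (u : V) (v : W) :
    (join G H).Adj (Sum.inl u) (Sum.inr v) := by simp [join]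

@[simp] theorem join_adj_inr_inl (G : SimpleGraph V) (H : SimpleGraph W) (u : V) (v : W) :
    (join G H).Adj (Sum.inr v) (Sum.inl u) := by simp [join]

theorem join_mono {G G' : SimpleGraph V} {H H' : SimpleGraph W} (hG : G ≤ G') (hH : H ≤ H') :
    join G H ≤ join G' H' := by
  rintro (u | u) (v | v) h
  · simpa using hG (by simpa using h)
  · simp
  · simp
  · simpa using hH (by simpa using h)

theorem join_bot_bot : join (⊥ : SimpleGraph V) (⊥ : SimpleGraph W) =
    completeBipartiteGraph V W := by
  ext (u | u) (v | v) <;> simp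

theorem join_connected [Nonempty V] [Nonempty W] (G : SimpleGraph V) (H : SimpleGraph W) :
    (join G H).Connected := by
  obtain ⟨i⟩ := ‹Nonempty V›
  obtain ⟨j⟩ := ‹Nonempty W›
  rw [connected_iff_exists_forall_reachable]
  refine ⟨Sum.inl i, ?_⟩
  rintro (u | u)
  · exact (join_adj_inl_inr G H i j).reachable.trans (join_adj_inr_inl G H u j).reachable
  · exact (join_adj_inl_inr G H i u).reachable

theorem join_lt_join_left {G G' : SimpleGraph V} (H : SimpleGraph W) (h : G < G') :
    join G H < join G' H := by
  refine lt_of_le_of_ne (join_mono h.le le_rfl) fun he => h.ne ?_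
  ext u v
  rw [← join_adj_inl_inl G H, he, join_adj_inl_inl]

theorem join_lt_join_right {G G' : SimpleGraph V} {H H' : SimpleGraph W} (hG : G ≤ G')
    (h : H < H') : join G H < join G' H' := by
  refine lt_of_le_of_ne (join_mono hG h.le) fun he => h.ne ?_
  ext u v
  rw [← join_adj_inr_inr G H, he, join_adj_inr_inr]

theorem card_isLeft_le [Fintype V] {q : ℕ} {f : V → Fin q ⊕ W} (hf : Function.Injective f) :
    #{v | (f v).isLeft} ≤ q := by
  have h : ∀ v : {v // (f v).isLeft}, ∃ i, f v = Sum.inl i := fun v => Sum.isLeft_iff.1 v.2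
  choose g hg using h
  have hinj : Function.Injective g := fun u v huv => by
    apply Subtype.ext
    apply hf
    rw [hg, hg, huv]
  have := Fintype.card_le_of_injective g hinj
  rwa [Fintype.card_fin, Fintype.card_subtype] at this

/-- The right side is independent, so the vertices of a copy landing on the left form a cover.
Conversely, a copy of `F[S]` on the left extends to the right because `m` is large; an empty `S`
means that `F` has no edges. -/
theorem free_join_bot_iff [Fintype V] (F : SimpleGraph V) {q m : ℕ} (hm : Fintype.card V ≤ m)
    (Q : SimpleGraph (Fin q)) :
    F.Free (join Q (⊥ : SimpleGraph (Fin m))) ↔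
      ∀ S : Finset V, F.IsVertexCover (S : Set V) → #S ≤ q →
        (F.induce (S : Set V)).Free Q := by
  constructor
  · rintro hfree S hS - ⟨g⟩
    rcases S.eq_empty_or_nonempty with rfl | ⟨s, hs⟩
    · have hbot : F = ⊥ := by simpa using hS
      refine hfree (hbot ▸ ?_)
      obtain ⟨e⟩ : Nonempty (V ↪ Fin m) :=
        Function.Embedding.nonempty_of_card_le (by simpa using hm)
      exact ⟨Copy.bot (e.trans Function.Embedding.inr)⟩
    · refine hfree (isContained_of_cover (S : Set V) hS
        (fun v => Sum.inl (if h : v ∈ S then g ⟨v, h⟩ else g ⟨s, hs⟩)) ?_ ?_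
        (univ.map Function.Embedding.inr) ?_ (by simpa using hm))
      · intro u hu v hv huv
        rw [mem_coe] at hu hv
        simp only [hu, hv, dite_true, Sum.inl.injEq] at huv
        simpa using g.injective huv
      · intro u hu v hv huv
        rw [mem_coe] at hu hv
        simp only [hu, hv, dite_true, join_adj_inl_inl]
        exact g.toHom.map_adj (show (F.induce (S : Set V)).Adj ⟨u, hu⟩ ⟨v, hv⟩ from huv)
      · intro u hu w hw
        rw [mem_map] at hw
        obtain ⟨j, -, rfl⟩ := hw
        simp
  · rintro h ⟨f⟩
    have hadj : ∀ u v, F.Adj u v → (join Q (⊥ : SimpleGraph (Fin m))).Adj (f u) (f v) :=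
      fun u v huv => f.toHom.map_adj huv
    set S : Finset V := {v | (f v).isLeft} with hS
    refine h S ?_ (card_isLeft_le f.injective) ?_
    · intro u v huv
      have := hadj u v huv
      rw [mem_coe, mem_coe, hS, mem_filter, mem_filter]
      rcases hu : f u with i | i <;> rcases hv : f v with j | j <;> simp [hu, hv] at this ⊢
    · have hl : ∀ v : (S : Set V), ∃ i, f v = Sum.inl i := fun v =>
        Sum.isLeft_iff.1 (mem_filter.1 (mem_coe.1 v.2)).2
      choose g hg using hl
      refine isContained_of_injective g (fun u v huv => ?_) fun u v huv => ?_
      · apply Subtype.ext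
        apply f.injective
        change f u = f v
        rw [hg, hg, huv]
      · have := hadj u v huv
        rwa [hg, hg, join_adj_inl_inl] at this

/-- A connected graph has only one bipartition, so all of `A` or all of `B` would have to fit into
the `q` left vertices. -/
theorem free_completeBipartite [Fintype V] {F : SimpleGraph V} (hF : F.Connected)
    {A B : Finset V} (hbip : F.IsBipartiteWith (A : Set V) (B : Set V))
    (hunion : A ∪ B = univ) {q : ℕ} (hA : q < #A) (hB : q < #B) :
    F.Free (completeBipartiteGraph (Fin q) W) := by
  rintro ⟨f⟩
  have hBA : ∀ v, v ∈ B ↔ v ∉ A := fun v => by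
    refine ⟨fun hB hA => Set.disjoint_left.1 hbip.disjoint hA hB, fun hv => ?_⟩
    have : v ∈ A ∪ B := by rw [hunion]; exact mem_univ v
    exact (mem_union.1 this).resolve_left hv
  have hstep : ∀ u v, F.Adj u v → (((f u).isLeft ↔ u ∈ A) ↔ ((f v).isLeft ↔ v ∈ A)) := by
    intro u v huv
    have h1 : (completeBipartiteGraph (Fin q) W).Adj (f u) (f v) := f.toHom.map_adj huv
    have h2 : (u ∈ A ↔ v ∉ A) := by
      have h := hbip.mem_of_adj huv
      simp only [mem_coe, hBA] at h
      tauto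
    have h3 : (f u).isLeft ↔ ¬ (f v).isLeft := by
      rcases hu : f u with i | i <;> rcases hv : f v with j | j <;> simp [hu, hv] at h1 ⊢
    tauto
  have hconst : ∀ u v, (((f u).isLeft ↔ u ∈ A) ↔ ((f v).isLeft ↔ v ∈ A)) := by
    intro u v
    obtain ⟨p⟩ := hF.preconnected u v
    induction p with
    | nil => rfl
    | cons h p ih => exact (hstep _ _ h).trans ih
  obtain ⟨v₀⟩ := hF.nonempty
  have hle := card_isLeft_le f.injective
  by_cases h0 : ((f v₀).isLeft ↔ v₀ ∈ A)
  · have : A ⊆ ({v | (f v).isLeft} : Finset V) := fun v hv => by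
      rw [mem_filter]; exact ⟨mem_univ _, ((hconst v₀ v).1 h0).2 hv⟩
    exact absurd ((Finset.card_le_card this).trans hle) (by lia)
  · have : B ⊆ ({v | (f v).isLeft} : Finset V) := fun v hv => by
      rw [mem_filter]
      have h1 : ¬ ((f v).isLeft ↔ v ∈ A) := fun h => h0 ((hconst v₀ v).2 h)
      have h2 := (hBA v).1 hv
      exact ⟨mem_univ _, by tauto⟩
    exact absurd ((Finset.card_le_card this).trans hle) (by lia)

/-- The case split in the definition disappears on `q` vertices: when the cover number is `q + 1`,
no cover is small enough, and `K_{q+1}` does not fit. -/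
theorem familyFree_coverFamily_iff (F : SimpleGraph V) {q : ℕ} (Q : SimpleGraph (Fin q)) :
    FamilyFree (coverFamily F q) Q ↔
      ∀ S : Finset V, F.IsVertexCover (S : Set V) → #S ≤ q →
        (F.induce (S : Set V)).Free Q := by
  unfold coverFamily FamilyFree
  split_ifs with hβ
  · constructor
    · intro _ S hS hSq
      have h1 := hS.vertexCoverNum_le
      rw [hβ, Set.encard_coe_eq_coe_finsetCard] at h1
      have : q + 1 ≤ #S := by exact_mod_cast h1
      lia
    · rintro - ⟨k, H⟩ ⟨e⟩ ⟨f⟩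
      have e' := e.symm.toEquiv
      have := Fintype.card_le_of_injective (fun i => f (e' i)) (f.injective.comp e'.injective)
      simp at this
  · constructor
    · intro h S hS hSq
      have e : S ≃ Fin #S := S.equivFin
      have i : (F.induce (S : Set V)).comap e.symm ≃g F.induce (S : Set V) :=
        SimpleGraph.Iso.comap e.symm _
      have := h ⟨#S, (F.induce (S : Set V)).comap e.symm⟩ ⟨S, hS, hSq, ⟨i⟩⟩
      exact (free_congr_left i).1 this
    · rintro h ⟨k, H⟩ ⟨S, hS, hSq, ⟨i⟩⟩
      exact (free_congr_left i).2 (h S hS hSq)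

end Join

/-! ### Edge counts in forests and adding one edge -/

section Forest

variable {V : Type*}

theorem IsAcyclic.sum_card_adj_add_two_le {F : SimpleGraph V} (hF : F.IsAcyclic) {Z : Finset V}
    (hZ : Z.Nonempty) : ∑ v ∈ Z, #{w ∈ Z | F.Adj v w} + 2 ≤ 2 * #Z := by
  have : Nonempty Z := hZ.to_subtype
  -- The forest induced on `Z` is extended to a spanning tree of the complete graph on `Z`, whose
  -- edge count is known.
  obtain ⟨T, hFT, -, hT⟩ := (connected_top (V := Z)).exists_isTree_le_of_le_of_isAcyclic
    (H := F.comap ((↑) : Z → V)) le_top (hF.comap ⟨(↑), id⟩ Subtype.val_injective)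
  have h1 := hT.card_edgeFinset
  have h2 := T.sum_degrees_eq_twice_card_edges
  rw [Fintype.card_coe] at h1
  have h3 : ∑ v ∈ Z, #{w ∈ Z | F.Adj v w} ≤ ∑ v : Z, T.degree v := by
    rw [← Finset.sum_coe_sort Z]
    refine Finset.sum_le_sum fun v _ => ?_
    rw [← card_neighborFinset_eq_degree, ← Finset.card_map (Function.Embedding.subtype _)]
    refine Finset.card_le_card fun w hw => ?_
    rw [mem_filter] at hw
    rw [mem_map]
    refine ⟨⟨w, hw.1⟩, ?_, rfl⟩
    rw [mem_neighborFinset]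
    exact hFT hw.2
  lia

theorem IsAcyclic.sum_card_adj_lt {F : SimpleGraph V} (hF : F.IsAcyclic) {X Y : Finset V}
    (hX : X.Nonempty) (hXY : Disjoint X Y) :
    ∑ a ∈ X, #{b ∈ Y | F.Adj a b} < #X + #Y := by
  have h1 := IsAcyclic.sum_card_adj_add_two_le hF (hX.mono (Finset.subset_union_left (s₂ := Y)))
  rw [Finset.sum_union hXY, Finset.card_union_of_disjoint hXY] at h1
  have h2 : ∑ a ∈ X, #{b ∈ Y | F.Adj a b} ≤ ∑ a ∈ X, #{w ∈ X ∪ Y | F.Adj a w} :=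
    Finset.sum_le_sum fun a _ => Finset.card_le_card
      (Finset.filter_subset_filter _ Finset.subset_union_right)
  have h3 : ∑ b ∈ Y, #{a ∈ X | F.Adj a b} ≤ ∑ b ∈ Y, #{w ∈ X ∪ Y | F.Adj b w} := by
    refine Finset.sum_le_sum fun b _ => ?_
    simp only [F.adj_comm _ b]
    exact Finset.card_le_card (Finset.filter_subset_filter _ Finset.subset_union_left)
  have h4 : ∑ a ∈ X, #{b ∈ Y | F.Adj a b} = ∑ b ∈ Y, #{a ∈ X | F.Adj a b} :=
    Finset.sum_card_bipartiteAbove_eq_sum_card_bipartiteBelow _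
  lia

/-- If every vertex of `A` has degree at least two, then adding one edge outside the clique of
`K_q ∇ mK₁` creates no copy of `F`. -/
theorem free_join_top_edge [Fintype V] {W : Type*} {F : SimpleGraph V} (hF : F.IsAcyclic) {A B : Finset V}
    (hbip : F.IsBipartiteWith (A : Set V) (B : Set V)) {q : ℕ} (hA : #A = q + 1)
    (hdeg : ∀ a ∈ A, 2 ≤ F.degree a) (i j : W) :
    F.Free (join (⊤ : SimpleGraph (Fin q)) (edge i j)) := by
  rintro ⟨f⟩
  have hadj : ∀ u v, F.Adj u v →
      (join (⊤ : SimpleGraph (Fin q)) (edge i j)).Adj (f u) (f v) :=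
    fun u v huv => f.toHom.map_adj huv
  set S : Finset V := {v | (f v).isLeft} with hS
  have hSq : #S ≤ q := card_isLeft_le f.injective
  have hAB : ∀ v, v ∈ A → v ∉ B := fun v hv => Set.disjoint_left.1 hbip.disjoint hv
  have hout : ∀ u v, F.Adj u v → u ∉ S → v ∉ S →
      (f u = Sum.inr i ∧ f v = Sum.inr j) ∨ (f u = Sum.inr j ∧ f v = Sum.inr i) := by
    intro u v huv hu hv
    have h := hadj u v huv
    rw [hS, mem_filter] at hu hv
    rcases hu' : f u with k | k <;> rcases hv' : f v with l | l <;>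
      simp [hu', hv', edge_adj] at h hu hv ⊢
    tauto
  set X := A \ S with hX
  set Y := B ∩ S with hY
  have hXY : Disjoint X Y := Finset.disjoint_left.2 fun v h1 h2 =>
    hAB v (mem_sdiff.1 h1).1 (mem_inter.1 h2).1
  -- As `S` has at most `q = #A - 1` vertices, more of `A` lies outside `S` than of `B` inside.
  have hcard : #Y + 1 ≤ #X := by
    have h1 : #X + #(A ∩ S) = #A := Finset.card_sdiff_add_card_inter A S
    have h2 : #(A ∩ S) + #Y ≤ #S := by
      rw [← Finset.card_union_of_disjoint]
      · exact Finset.card_le_card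
          (Finset.union_subset Finset.inter_subset_right Finset.inter_subset_right)
      · exact Finset.disjoint_left.2 fun v h1 h2 =>
          hAB v (mem_inter.1 h1).1 (mem_inter.1 h2).1
    lia
  have hXne : X.Nonempty := Finset.card_pos.1 (by lia)
  have hlt := IsAcyclic.sum_card_adj_lt hF hXne hXY
  have hnbr : ∀ a ∈ A, ∀ v, F.Adj a v → v ∈ B := fun a ha v hav => by
    rcases hbip.mem_of_adj hav with h | h
    · exact h.2
    · exact absurd h.1 (hAB a ha)
  have hdeg' : ∀ a ∈ X, 2 ≤ #{b ∈ Y | F.Adj a b} + #{b ∈ Sᶜ | F.Adj a b} := by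
    intro a ha
    have haA := (mem_sdiff.1 ha).1
    refine (hdeg a haA).trans ?_
    rw [← card_neighborFinset_eq_degree]
    refine le_trans (Finset.card_le_card fun v hv => ?_) (Finset.card_union_le _ _)
    rw [mem_neighborFinset] at hv
    rw [mem_union, mem_filter, mem_filter, hY, mem_inter, mem_compl]
    by_cases hvS : v ∈ S
    · exact Or.inl ⟨⟨hnbr a haA v hv, hvS⟩, hv⟩
    · exact Or.inr ⟨hvS, hv⟩
  -- Only the added edge joins two vertices off the clique. Hence `2 * #X ≤ e(X, Y) + 1`, while
  -- acyclicity gives `e(X, Y) < #X + #Y < 2 * #X`.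
  have hone : ∑ a ∈ X, #{b ∈ Sᶜ | F.Adj a b} ≤ 1 := by
    rw [← Finset.card_sigma, Finset.card_le_one]
    rintro ⟨a, b⟩ h ⟨a', b'⟩ h'
    rw [mem_sigma, mem_filter, mem_compl, hX, mem_sdiff] at h h'
    dsimp only at h h'
    obtain ⟨⟨haA, haS⟩, hbS, hab⟩ := h
    obtain ⟨⟨haA', haS'⟩, hbS', hab'⟩ := h'
    have key : ∀ u v, u ∈ A → (∃ w ∈ A, F.Adj w v) → f u = f v → False := by
      rintro u v hu ⟨w, hw, hwv⟩ huv
      exact hAB u hu (f.injective huv ▸ hnbr w hw v hwv)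
    have hab2 : a = a' ∧ b = b' := by
      rcases hout a b hab haS hbS with h | h <;> rcases hout a' b' hab' haS' hbS' with h' | h'
      · exact ⟨f.injective (h.1.trans h'.1.symm), f.injective (h.2.trans h'.2.symm)⟩
      · exact (key a b' haA ⟨a', haA', hab'⟩ (h.1.trans h'.2.symm)).elim
      · exact (key a b' haA ⟨a', haA', hab'⟩ (h.1.trans h'.2.symm)).elim
      · exact ⟨f.injective (h.1.trans h'.1.symm), f.injective (h.2.trans h'.2.symm)⟩
    obtain ⟨rfl, rfl⟩ := hab2
    rfl
  have hsum := Finset.sum_le_sum hdeg'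
  rw [Finset.sum_const, smul_eq_mul, Finset.sum_add_distrib] at hsum
  lia

end Forest

/-! ### Spectral radius of a join by its number of edges -/

section JoinSpectrum

variable {q m : ℕ}

theorem sum_nbrSum_one (Q : SimpleGraph (Fin q)) :
    ∑ i, nbrSum Q (fun _ => 1) i = 2 * (#Q.edgeFinset : ℝ) := by
  have h := Q.sum_degrees_eq_twice_card_edges
  have h1 : ∀ i, nbrSum Q (fun _ => 1) i = (Q.degree i : ℝ) := fun i => by
    rw [nbrSum, ← Finset.sum_filter, Finset.sum_const, nsmul_eq_mul, mul_one,
      ← card_neighborFinset_eq_degree, neighborFinset_eq_filter]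
  simp only [h1]
  exact_mod_cast h

theorem nbrSum_join_inl (Q : SimpleGraph (Fin q)) (x : Fin q ⊕ Fin m → ℝ) (i : Fin q) :
    nbrSum (join Q (⊥ : SimpleGraph (Fin m))) x (Sum.inl i) =
      nbrSum Q (fun i => x (Sum.inl i)) i + ∑ j, x (Sum.inr j) := by
  simp [nbrSum, Fintype.sum_sum_type]

theorem nbrSum_join_inr (Q : SimpleGraph (Fin q)) (x : Fin q ⊕ Fin m → ℝ) (j : Fin m) :
    nbrSum (join Q (⊥ : SimpleGraph (Fin m))) x (Sum.inr j) = ∑ i, x (Sum.inl i) := by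
  simp [nbrSum, Fintype.sum_sum_type]

theorem le_rho_join (hq : 1 ≤ q) (hm : 1 ≤ m) (Q : SimpleGraph (Fin q)) :
    Real.sqrt (q * m) + #Q.edgeFinset / q ≤ rho (join Q (⊥ : SimpleGraph (Fin m))) := by
  have hq0 : (0 : ℝ) < q := by exact_mod_cast hq
  have hm0 : (0 : ℝ) < m := by exact_mod_cast hm
  set p := Real.sqrt (q * m) with hp
  have hp2 : p ^ 2 = q * m := Real.sq_sqrt (by positivity)
  -- The test vector is the Perron vector of the complete bipartite graph, for which the edges of
  -- `Q` contribute exactly `#Q.edgeFinset / q`.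
  have h := quadForm_le_rho (join Q (⊥ : SimpleGraph (Fin m)))
    (Sum.elim (fun _ => 1) (fun _ => p / m))
  simp only [Fintype.sum_sum_type, nbrSum_join_inl, nbrSum_join_inr, Sum.elim_inl, Sum.elim_inr,
    Finset.sum_const, Finset.card_univ, Fintype.card_fin, nsmul_eq_mul, one_mul,
    Finset.sum_add_distrib, sum_nbrSum_one] at h
  have e1 : (m : ℝ) * (p / m) = p := by field_simp
  have e2 : (m : ℝ) * (p / m) ^ 2 = q := by
    rw [div_pow, hp2]; field_simp
  have e3 : (m : ℝ) * (p / m * (q * 1)) = q * p := by field_simp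
  rw [e1, e2, e3] at h
  have e4 : p + #Q.edgeFinset / q = (2 * #Q.edgeFinset + q * p + q * p) / (2 * q) := by
    field_simp; ring
  rw [e4, div_le_iff₀ (by positivity)]
  linarith

/-- Summing the eigenvalue equation over the left side leaves the edges of `Q` as the only
correction to `q * m`. Each left entry is at most `(lam + m) / lam ^ 2` times their sum, which
bounds that correction. -/
theorem rho_join_sq_le (hq : 1 ≤ q) (hm : 1 ≤ m) (Q : SimpleGraph (Fin q)) :
    rho (join Q (⊥ : SimpleGraph (Fin m))) ^ 2 ≤ q * m +
      2 * #Q.edgeFinset * (1 + rho (join Q (⊥ : SimpleGraph (Fin m))) / q) := by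
  have hq0 : (0 : ℝ) < q := by exact_mod_cast hq
  have hm0 : (0 : ℝ) < m := by exact_mod_cast hm
  have : Nonempty (Fin q) := ⟨⟨0, hq⟩⟩
  have hlow := le_rho_join hq hm Q
  obtain ⟨x, hx0, hx1, hxe⟩ := exists_perron (join Q (⊥ : SimpleGraph (Fin m)))
  set lam := rho (join Q (⊥ : SimpleGraph (Fin m)))
  set e : ℝ := (#Q.edgeFinset : ℝ) with he
  have he0 : 0 ≤ e := by positivity
  have hp : 0 < Real.sqrt (q * m) := Real.sqrt_pos.2 (by positivity)
  have hplam : Real.sqrt (q * m) ≤ lam := by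
    have : 0 ≤ e / q := by positivity
    linarith
  have hlam0 : 0 < lam := hp.trans_le hplam
  have hlam2 : q * m ≤ lam ^ 2 := by
    rw [← Real.sq_sqrt (by positivity : (0 : ℝ) ≤ q * m)]
    exact pow_le_pow_left₀ hp.le hplam 2
  set y : Fin q → ℝ := fun i => x (Sum.inl i) with hy
  set s := ∑ i, y i with hs
  set t := ∑ j, x (Sum.inr j) with ht
  have hy0 : ∀ i, 0 ≤ y i := fun i => hx0 _
  have hz : ∀ j, lam * x (Sum.inr j) = s := fun j => by rw [← hxe, nbrSum_join_inr]
  have hyi : ∀ i, lam * y i = nbrSum Q y i + t := fun i => by rw [hy, ← hxe, nbrSum_join_inl]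
  have hlt : lam * t = m * s := by
    rw [ht, Finset.mul_sum, Finset.sum_congr rfl fun j _ => hz j, Finset.sum_const,
      Finset.card_univ, Fintype.card_fin, nsmul_eq_mul]
  have hs0 : 0 ≤ s := Finset.sum_nonneg fun i _ => hy0 i
  have hspos : 0 < s := by
    refine lt_of_le_of_ne hs0 fun h => ?_
    have h1 : ∀ i, y i = 0 := fun i =>
      (Finset.sum_eq_zero_iff_of_nonneg fun _ _ => hy0 _).1 h.symm i (mem_univ _)
    have h2 : ∀ j, x (Sum.inr j) = 0 := fun j => by
      have := hz j
      rw [← h] at this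
      exact (mul_eq_zero.1 this).resolve_left hlam0.ne'
    have h3 : ∀ v, x v = 0 := by
      rintro (i | j)
      · exact h1 i
      · exact h2 j
    simp [h3] at hx1
  have hyle : ∀ i, lam ^ 2 * y i ≤ (lam + m) * s := fun i => by
    have h1 : nbrSum Q y i ≤ s :=
      Finset.sum_le_sum fun k _ => by split_ifs <;> simp [hy0]
    have h2 : lam * (lam * y i) ≤ lam * (s + t) := by
      rw [hyi]; exact mul_le_mul_of_nonneg_left (by linarith) hlam0.le
    nlinarith
  have hsum : lam * s = ∑ i, nbrSum Q y i + q * t := by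
    rw [hs, Finset.mul_sum, Finset.sum_congr rfl fun i _ => hyi i, Finset.sum_add_distrib,
      Finset.sum_const, Finset.card_univ, Fintype.card_fin, nsmul_eq_mul]
  have hNs : lam ^ 2 * ∑ i, nbrSum Q y i ≤ 2 * e * ((lam + m) * s) := by
    rw [he, ← sum_nbrSum_one, Finset.mul_sum, Finset.sum_mul]
    refine Finset.sum_le_sum fun i _ => ?_
    rw [nbrSum, nbrSum, Finset.mul_sum, Finset.sum_mul]
    refine Finset.sum_le_sum fun k _ => ?_
    split_ifs
    · rw [one_mul]; exact hyle k
    · simp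
  have hmain : lam ^ 3 ≤ 2 * e * (lam + m) + lam * (q * m) := by
    have h1 : lam ^ 3 * s ≤ (2 * e * (lam + m) + lam * (q * m)) * s := by
      have h2 : lam ^ 3 * s = lam ^ 2 * (∑ i, nbrSum Q y i + q * t) := by rw [← hsum]; ring
      have h3 : lam ^ 2 * (q * t) = lam * (q * m) * s := by
        have : lam ^ 2 * (q * t) = lam * q * (lam * t) := by ring
        rw [this, hlt]; ring
      rw [h2, mul_add, h3]
      linarith
    exact le_of_mul_le_mul_right h1 hspos
  have hmq : (m : ℝ) ≤ lam ^ 2 / q := by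
    rw [le_div_iff₀ hq0]; linarith
  have h5 : lam * lam ^ 2 ≤ lam * (q * m + 2 * e * (1 + lam / q)) := by
    have h6 : 2 * e * (lam + m) ≤ 2 * e * (lam + lam ^ 2 / q) := by gcongr
    have h7 : lam * (q * m + 2 * e * (1 + lam / q)) =
        lam * (q * m) + 2 * e * (lam + lam ^ 2 / q) := by field_simp
    rw [h7]
    linarith
  exact le_of_mul_le_mul_left h5 hlam0

/-- One more edge raises the lower bound by `1 / q`. After completing the square this is a gain of
`2 * p / q` with `p = √(q * m)`, against an error of at most `2 * q ^ 2`; `q ^ 6 < m` gives `p > q ^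
3`. -/
theorem rho_join_lt_of_card_lt (hq : 1 ≤ q) (hm : q ^ 6 < m) {Q Q' : SimpleGraph (Fin q)}
    (h : #Q.edgeFinset < #Q'.edgeFinset) :
    rho (join Q (⊥ : SimpleGraph (Fin m))) < rho (join Q' (⊥ : SimpleGraph (Fin m))) := by
  have hm1 : 1 ≤ m := by lia
  have hq0 : (0 : ℝ) < q := by exact_mod_cast hq
  have hq1 : (1 : ℝ) ≤ q := by exact_mod_cast hq
  have h1 := rho_join_sq_le hq hm1 Q
  have h2 := le_rho_join hq hm1 Q'
  refine lt_of_not_ge fun hc => ?_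
  set lam := rho (join Q (⊥ : SimpleGraph (Fin m)))
  set e : ℝ := (#Q.edgeFinset : ℝ) with he
  have he' : e + 1 ≤ #Q'.edgeFinset := by rw [he]; exact_mod_cast h
  have he0 : 0 ≤ e := by positivity
  have heq : 2 * e ≤ q ^ 2 := by
    rw [he, ← sum_nbrSum_one]
    calc ∑ i, nbrSum Q (fun _ => 1) i ≤ ∑ i : Fin q, ∑ j : Fin q, (1 : ℝ) :=
          Finset.sum_le_sum fun i _ => Finset.sum_le_sum fun j _ => by split_ifs <;> simp
      _ = q ^ 2 := by simp; ring
  set p := Real.sqrt (q * m) with hp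
  have hp2 : p ^ 2 = q * m := Real.sq_sqrt (by positivity)
  have hpq : (q : ℝ) ^ 3 < p := by
    apply Real.lt_sqrt_of_sq_lt
    have h3 : (q : ℝ) ^ 6 < m := by exact_mod_cast hm
    have h4 : (m : ℝ) ≤ q * m := le_mul_of_one_le_left (by positivity) hq1
    have h5 : ((q : ℝ) ^ 3) ^ 2 = (q : ℝ) ^ 6 := by ring
    rw [h5]
    exact h3.trans_le h4
  have h3 : p + (e + 1) / q ≤ lam := by
    have : (e + 1) / q ≤ #Q'.edgeFinset / q := by gcongr
    linarith
  have hp0 : 0 ≤ p := Real.sqrt_nonneg _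
  have h4 : p + 1 / q ≤ lam - e / q := by
    have : (e + 1) / q = e / q + 1 / q := by ring
    linarith
  have h5 : (p + 1 / q) ^ 2 ≤ (lam - e / q) ^ 2 :=
    pow_le_pow_left₀ (by positivity) h4 2
  have h6 : (lam - e / q) ^ 2 = lam ^ 2 - 2 * e * (lam / q) + (e / q) ^ 2 := by ring
  have h7 : (p + 1 / q) ^ 2 = p ^ 2 + 2 * (p / q) + (1 / q) ^ 2 := by ring
  have h8 : (q : ℝ) ^ 2 < p / q := by
    rw [lt_div_iff₀ hq0]
    calc (q : ℝ) ^ 2 * q = q ^ 3 := by ring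
      _ < p := hpq
  have h9 : (e / q) ^ 2 ≤ q ^ 2 := by
    refine pow_le_pow_left₀ (by positivity) ?_ 2
    rw [div_le_iff₀ hq0]
    nlinarith
  have h10 : 0 ≤ (1 / (q : ℝ)) ^ 2 := by positivity
  rw [h6, h7, hp2] at h5
  linarith

end JoinSpectrum

/-! ### Transfer along isomorphisms and existence of extremal graphs -/

section Assembly

variable {V : Type*}

theorem exists_iso_fin {q n : ℕ} (hqn : q ≤ n) (H : SimpleGraph (Fin q ⊕ Fin (n - q))) :
    ∃ G : SimpleGraph (Fin n), Nonempty (G ≃g H) := by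
  have e : Fin n ≃ Fin q ⊕ Fin (n - q) :=
    (finCongr (by lia)).trans finSumFinEquiv.symm
  exact ⟨H.comap e, ⟨SimpleGraph.Iso.comap e H⟩⟩

theorem SPEX_nonempty {F : SimpleGraph V} {n : ℕ} {G₀ : SimpleGraph (Fin n)} (h : F.Free G₀) :
    (SPEX n F).Nonempty := by
  obtain ⟨G, hG, hmax⟩ := Set.exists_max_image {G : SimpleGraph (Fin n) | F.Free G} rho
    (Set.toFinite _) ⟨G₀, h⟩
  exact ⟨G, hG, hmax⟩

theorem mem_SPEX_of_iso {F : SimpleGraph V} {n : ℕ} (hn : 0 < n) {G H : SimpleGraph (Fin n)}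
    (e : H ≃g G) (hG : G ∈ SPEX n F) : H ∈ SPEX n F := by
  have : Nonempty (Fin n) := ⟨⟨0, hn⟩⟩
  refine ⟨(free_congr_right e).2 hG.1, fun G' hG' => ?_⟩
  rw [rho_congr e]
  exact hG.2 G' hG'

/-- No `F`-free graph on the same number of vertices beats a member of `SPEX`. -/
theorem rho_le_of_mem_SPEX {F : SimpleGraph V} {q n : ℕ} (hn : 0 < n) (hqn : q ≤ n)
    {G : SimpleGraph (Fin n)} (hG : G ∈ SPEX n F) {H : SimpleGraph (Fin q ⊕ Fin (n - q))}
    (hH : F.Free H) : rho H ≤ rho G := by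
  have : Nonempty (Fin n) := ⟨⟨0, hn⟩⟩
  obtain ⟨G', ⟨e⟩⟩ := exists_iso_fin hqn H
  rw [← rho_congr e]
  exact hG.2 G' ((free_congr_right e).2 hH)

/-- A member of `SPEX` is not isomorphic to a proper subgraph of a connected `F`-free graph. -/
theorem not_lt_of_mem_SPEX {F : SimpleGraph V} {q n : ℕ} (hn : 0 < n) (hqn : q ≤ n)
    {G : SimpleGraph (Fin n)} (hG : G ∈ SPEX n F) {H H' : SimpleGraph (Fin q ⊕ Fin (n - q))}
    (e : G ≃g H) (hH' : F.Free H') (hconn : H'.Connected) : ¬ H < H' := by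
  intro hlt
  have : Nonempty (Fin n) := ⟨⟨0, hn⟩⟩
  have : Nonempty (Fin q ⊕ Fin (n - q)) := hconn.nonempty
  have h1 := rho_lt_of_lt hlt hconn
  have h2 := rho_le_of_mem_SPEX hn hqn hG hH'
  rw [rho_congr e] at h2
  linarith

theorem exists_iso_join {q n : ℕ} {G : SimpleGraph (Fin n)} {L : Finset (Fin n)} (hL : #L = q)
    (h : ∀ v ∉ L, ∀ w, G.Adj v w ↔ w ∈ L) :
    ∃ Q : SimpleGraph (Fin q), Nonempty (G ≃g join Q (⊥ : SimpleGraph (Fin (n - q)))) := by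
  have e₁ : {v // v ∈ L} ≃ Fin q := Fintype.equivFinOfCardEq (by simp [hL])
  have e₂ : {v // v ∉ L} ≃ Fin (n - q) := Fintype.equivFinOfCardEq (by
    rw [Fintype.card_subtype_compl]; simp [hL])
  refine ⟨G.comap fun i => (e₁.symm i : Fin n), ⟨RelIso.symm
    ⟨(Equiv.sumCongr e₁.symm e₂.symm).trans (Equiv.sumCompl (· ∈ L)), ?_⟩⟩⟩
  rintro (i | i) (j | j)
  · simp
  · simpa using ((h _ (e₂.symm j).2 _).2 (e₁.symm i).2).symm
  · simpa using (h _ (e₂.symm i).2 _).2 (e₁.symm j).2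
  · simpa [h _ (e₂.symm i).2] using (e₂.symm j).2

theorem mem_EX_iff {q : ℕ} {𝒜 : GraphFamily} {Q : SimpleGraph (Fin q)} :
    Q ∈ EX q 𝒜 ↔ FamilyFree 𝒜 Q ∧
      ∀ Q' : SimpleGraph (Fin q), FamilyFree 𝒜 Q' → #Q'.edgeFinset ≤ #Q.edgeFinset := by
  constructor
  · rintro ⟨h1, h2⟩
    refine ⟨h1, fun Q' hQ' => ?_⟩
    convert h2 hQ'
  · rintro ⟨h1, h2⟩
    refine ⟨h1, fun Q' _ hQ' => ?_⟩
    convert h2 Q' hQ'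

theorem EX_nonempty {q : ℕ} {𝒜 : GraphFamily} {Q₀ : SimpleGraph (Fin q)}
    (h : FamilyFree 𝒜 Q₀) : (EX q 𝒜).Nonempty := by
  obtain ⟨Q, hQ, hmax⟩ := Set.exists_max_image {Q : SimpleGraph (Fin q) | FamilyFree 𝒜 Q}
    (fun Q => #Q.edgeFinset) (Set.toFinite _) ⟨Q₀, h⟩
  exact ⟨Q, mem_EX_iff.2 ⟨hQ, hmax⟩⟩

theorem mem_isoClass_bot {q : ℕ} {Q : SimpleGraph (Fin q)} :
    Q ∈ isoClass q (⊥ : SimpleGraph (Fin q)) ↔ Q = ⊥ := by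
  constructor
  · rintro ⟨e⟩
    ext u v
    rw [← e.map_adj_iff]
    simp
  · rintro rfl
    exact ⟨SimpleGraph.Iso.refl⟩

theorem SPEX_eq_isoClass {W : Type*} {F : SimpleGraph V} {n : ℕ} (hn : 0 < n)
    (hne : (SPEX n F).Nonempty) {X : SimpleGraph W}
    (h : ∀ G ∈ SPEX n F, Nonempty (G ≃g X)) : SPEX n F = isoClass n X := by
  refine Set.Subset.antisymm h ?_
  rintro H ⟨e⟩
  obtain ⟨G, hG⟩ := hne
  obtain ⟨e'⟩ := h G hG
  exact mem_SPEX_of_iso hn (e.trans e'.symm) hG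

theorem minDegreeOn_eq_one_or_forall [Fintype V] {F : SimpleGraph V} (hF : F.Connected)
    {A : Finset V} (hA : 2 ≤ #A) :
    (minDegreeOn F A = 1 ∧ ∃ a ∈ A, F.degree a = 1) ∨
      (minDegreeOn F A ≠ 1 ∧ ∀ a ∈ A, 2 ≤ F.degree a) := by
  have hne : A.Nonempty := Finset.card_pos.1 (by lia)
  have hnt : Nontrivial V := by
    obtain ⟨a, -, b, -, hab⟩ := Finset.one_lt_card.1 (by lia : 1 < #A)
    exact ⟨a, b, hab⟩
  have hmem : minDegreeOn F A ∈ (fun x => F.degree x) '' (A : Set V) :=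
    Nat.sInf_mem (hne.to_set.image _)
  have hle : ∀ a ∈ A, minDegreeOn F A ≤ F.degree a := fun a ha =>
    Nat.sInf_le ⟨a, ha, rfl⟩
  obtain ⟨a, ha, hae⟩ := hmem
  by_cases h1 : minDegreeOn F A = 1
  · exact Or.inl ⟨h1, a, ha, hae.trans h1⟩
  · refine Or.inr ⟨h1, fun b hb => ?_⟩
    have h2 : 0 < F.degree a := hF.preconnected.degree_pos_of_nontrivial a
    have h3 := hle b hb
    dsimp only at hae
    lia

end Assembly

/-! ### The characterizations -/

section Main

variable {V : Type*} [Fintype V] {F : SimpleGraph V} {A B : Finset V} {q : ℕ}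

theorem not_iso_join_of_two_le_degree (hF : F.IsTree)
    (hbip : F.IsBipartiteWith (A : Set V) (B : Set V)) (hA : #A = q + 1) (hq : 1 ≤ q)
    (hdeg : ∀ a ∈ A, 2 ≤ F.degree a) {n : ℕ} (hn : q + 2 ≤ n) {G : SimpleGraph (Fin n)}
    (hG : G ∈ SPEX n F) (Q : SimpleGraph (Fin q)) :
    ¬ Nonempty (G ≃g join Q (⊥ : SimpleGraph (Fin (n - q)))) := by
  rintro ⟨e⟩
  have : Nonempty (Fin q) := ⟨⟨0, hq⟩⟩
  have : Nonempty (Fin (n - q)) := ⟨⟨0, by lia⟩⟩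
  let i : Fin (n - q) := ⟨0, by lia⟩
  let j : Fin (n - q) := ⟨1, by lia⟩
  have hij : i ≠ j := by simp [i, j]
  refine not_lt_of_mem_SPEX (by lia) (by lia) hG e
    (free_join_top_edge hF.isAcyclic hbip hA hdeg i j) (join_connected _ _)
    (join_lt_join_right le_top (bot_lt_iff_ne_bot.2 fun h => ?_))
  have h1 : (edge i j).Adj i j := by simp [edge_adj, hij]
  rw [h] at h1
  exact h1

theorem SPEX_subset_joinFamily (hF : F.IsTree)
    (hbip : F.IsBipartiteWith (A : Set V) (B : Set V)) (hunion : A ∪ B = univ)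
    (hcard : #A ≤ #B) (hA : #A = q + 1) (hq : 1 ≤ q) (hleaf : ∃ a ∈ A, F.degree a = 1) :
    ∃ N : ℕ, ∀ n : ℕ, N ≤ n → SPEX n F ⊆ joinFamily n q (coverFamily F q) := by
  obtain ⟨a, ha, hdeg⟩ := hleaf
  obtain ⟨b, hb⟩ := Finset.card_eq_one.1 hdeg
  have hab : F.Adj a b := by
    rw [← mem_neighborFinset, hb]; exact mem_singleton_self b
  have honly : ∀ v, F.Adj a v → v = b := fun v hv => by
    rwa [← mem_neighborFinset, hb, mem_singleton] at hv
  obtain ⟨N, hN⟩ := exists_adj_iff_mem_of_rho_max hF hbip hunion hA hq ha hab honly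
  refine ⟨N + q + q ^ 6 + Fintype.card V + 1, fun n hn G hG => ?_⟩
  have hqn : q ≤ n := by lia
  have hn0 : 0 < n := by lia
  have : Nonempty (Fin n) := ⟨⟨0, hn0⟩⟩
  have hV : Fintype.card V ≤ n - q := by lia
  -- The complete bipartite graph is the `F`-free competitor.
  have hrho : (q : ℝ) * (n - q) ≤ rho G ^ 2 := by
    have h1 : F.Free (join (⊥ : SimpleGraph (Fin q)) (⊥ : SimpleGraph (Fin (n - q)))) := by
      rw [join_bot_bot]
      exact free_completeBipartite hF.connected hbip hunion (by lia) (by lia)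
    have h2 := rho_le_of_mem_SPEX hn0 hqn hG h1
    have h3 := le_rho_join hq (by lia : 1 ≤ n - q) (⊥ : SimpleGraph (Fin q))
    have h4 : Real.sqrt (q * (n - q : ℕ)) ≤ rho G :=
      (le_add_of_nonneg_right (by positivity)).trans (h3.trans h2)
    have h5 := pow_le_pow_left₀ (Real.sqrt_nonneg _) h4 2
    rwa [Real.sq_sqrt (by positivity), Nat.cast_sub hqn] at h5
  obtain ⟨L, hL, hadj⟩ := hN (Fin n) n (Fintype.card_fin n) (by lia) G hG.1 hG.2 hrho
  obtain ⟨Q, ⟨e⟩⟩ := exists_iso_join hL hadj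
  have hff : ∀ Q : SimpleGraph (Fin q), FamilyFree (coverFamily F q) Q ↔
      F.Free (join Q (⊥ : SimpleGraph (Fin (n - q)))) := fun Q =>
    (familyFree_coverFamily_iff F Q).trans (free_join_bot_iff F hV Q).symm
  refine ⟨Q, mem_EX_iff.2 ⟨(hff Q).2 ((free_congr_right e).1 hG.1), fun Q' hQ' => ?_⟩, ⟨e⟩⟩
  by_contra! hlt
  have h1 := rho_join_lt_of_card_lt hq (by lia : q ^ 6 < n - q) hlt
  have h2 := rho_le_of_mem_SPEX hn0 hqn hG ((hff Q').1 hQ')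
  rw [rho_congr e] at h2
  linarith

theorem vertexCoverNum_eq_iff (hbip : F.IsBipartiteWith (A : Set V) (B : Set V))
    (hA : #A = q + 1) :
    F.vertexCoverNum = ((q + 1 : ℕ) : ℕ∞) ↔
      ∀ S : Finset V, F.IsVertexCover (S : Set V) → q < #S := by
  constructor
  · intro hβ S hS
    have h1 := hS.vertexCoverNum_le
    rw [hβ, Set.encard_coe_eq_coe_finsetCard] at h1
    exact_mod_cast h1
  · intro h
    refine le_antisymm ?_ ?_
    · have h1 := (isVertexCover_left hbip).vertexCoverNum_le
      rwa [Set.encard_coe_eq_coe_finsetCard, hA] at h1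
    · obtain ⟨S, hS, hcov⟩ := vertexCoverNum_exists F
      rw [← hS, ← Set.coe_toFinset S, Set.encard_coe_eq_coe_finsetCard]
      have := h S.toFinset (by rwa [Set.coe_toFinset])
      exact_mod_cast this

theorem SPEX_characterization (hF : F.IsTree)
    (hbip : F.IsBipartiteWith (A : Set V) (B : Set V)) (hunion : A ∪ B = univ)
    (hcard : #A ≤ #B) (hA : #A = q + 1) (hq : 1 ≤ q) :
    ∃ N : ℕ, ∀ n : ℕ, N ≤ n →
      (SPEX n F ⊆ joinFamily n q (coverFamily F q) ↔ minDegreeOn F A = 1) ∧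
      (SPEX n F = isoClass n (completeBipartiteGraph (Fin q) (Fin (n - q))) ↔
        minDegreeOn F A = 1 ∧
          EX q (coverFamily F q) = isoClass q (⊥ : SimpleGraph (Fin q))) ∧
      (SPEX n F = isoClass n (S0 n q) ↔
        minDegreeOn F A = 1 ∧ F.vertexCoverNum = ((q + 1 : ℕ) : ℕ∞)) := by
  obtain ⟨N, hN⟩ : ∃ N : ℕ, ∀ n : ℕ, N ≤ n → minDegreeOn F A = 1 →
      SPEX n F ⊆ joinFamily n q (coverFamily F q) := by
    rcases minDegreeOn_eq_one_or_forall hF.connected (by lia : 2 ≤ #A) with ⟨-, h⟩ | ⟨h, -⟩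
    · obtain ⟨N, hN⟩ := SPEX_subset_joinFamily hF hbip hunion hcard hA hq h
      exact ⟨N, fun n hn _ => hN n hn⟩
    · exact ⟨0, fun _ _ h' => absurd h' h⟩
  refine ⟨N + q + 2 + Fintype.card V, fun n hn => ?_⟩
  have hqn : q ≤ n := by lia
  have hn0 : 0 < n := by lia
  have : Nonempty (Fin q) := ⟨⟨0, hq⟩⟩
  have : Nonempty (Fin (n - q)) := ⟨⟨0, by lia⟩⟩
  have hsub := hN n (by lia)
  have hff : ∀ Q : SimpleGraph (Fin q), FamilyFree (coverFamily F q) Q ↔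
      F.Free (join Q (⊥ : SimpleGraph (Fin (n - q)))) := fun Q =>
    (familyFree_coverFamily_iff F Q).trans (free_join_bot_iff F (by lia) Q).symm
  have hKfree : F.Free (join (⊥ : SimpleGraph (Fin q)) (⊥ : SimpleGraph (Fin (n - q)))) := by
    rw [join_bot_bot]
    exact free_completeBipartite hF.connected hbip hunion (by lia) (by lia)
  have hne : (SPEX n F).Nonempty := by
    obtain ⟨G, ⟨e⟩⟩ := exists_iso_fin hqn
      (join (⊥ : SimpleGraph (Fin q)) (⊥ : SimpleGraph (Fin (n - q))))
    exact SPEX_nonempty ((free_congr_right e).2 hKfree)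
  have hδ : ∀ G ∈ SPEX n F, ∀ Q : SimpleGraph (Fin q),
      Nonempty (G ≃g join Q (⊥ : SimpleGraph (Fin (n - q)))) → minDegreeOn F A = 1 := by
    intro G hG Q he
    rcases minDegreeOn_eq_one_or_forall hF.connected (by lia : 2 ≤ #A) with ⟨h, -⟩ | ⟨-, h⟩
    · exact h
    · exact absurd he (not_iso_join_of_two_le_degree hF hbip hA hq h (by lia) hG Q)
  refine ⟨⟨fun h => ?_, hsub⟩, ⟨fun h => ?_, fun h => ?_⟩, ⟨fun h => ?_, fun h => ?_⟩⟩
  · obtain ⟨G, hG⟩ := hne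
    obtain ⟨Q, -, he⟩ := h hG
    exact hδ G hG Q he
  · obtain ⟨G, hG⟩ := hne
    obtain ⟨e⟩ : G ∈ isoClass n (completeBipartiteGraph (Fin q) (Fin (n - q))) := h ▸ hG
    rw [← join_bot_bot] at e
    refine ⟨hδ G hG ⊥ ⟨e⟩, ?_⟩
    -- Any nonempty admissible `Q` would give a connected `F`-free graph strictly above the extremal
    -- one.
    have hbot : ∀ Q ∈ EX q (coverFamily F q), Q = ⊥ := fun Q hQ => by
      by_contra hQ0
      exact not_lt_of_mem_SPEX hn0 hqn hG e ((hff Q).1 hQ.1) (join_connected _ _)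
        (join_lt_join_left _ (bot_lt_iff_ne_bot.2 hQ0))
    ext Q
    rw [mem_isoClass_bot]
    refine ⟨hbot Q, ?_⟩
    rintro rfl
    obtain ⟨Q, hQ⟩ := EX_nonempty ((hff ⊥).2 hKfree)
    exact hbot Q hQ ▸ hQ
  · refine SPEX_eq_isoClass hn0 hne fun G hG => ?_
    obtain ⟨Q, hQ, he⟩ := hsub h.1 hG
    rw [h.2, mem_isoClass_bot] at hQ
    rwa [hQ, join_bot_bot] at he
  · obtain ⟨G, hG⟩ := hne
    obtain ⟨e⟩ : G ∈ isoClass n (S0 n q) := h ▸ hG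
    refine ⟨hδ G hG ⊤ ⟨e⟩, (vertexCoverNum_eq_iff hbip hA).2 fun S hS => ?_⟩
    by_contra! hSq
    -- A cover of size at most `q` would embed its induced subgraph in the clique.
    refine (free_join_bot_iff F (by lia) ⊤).1 ((free_congr_right e).1 hG.1) S hS hSq ?_
    obtain ⟨g⟩ : Nonempty (S ↪ Fin q) :=
      Function.Embedding.nonempty_of_card_le (by simpa using hSq)
    exact isContained_of_injective g g.injective fun u v huv => by
      simpa using fun hc => huv.ne (by simpa using hc)
  · refine SPEX_eq_isoClass hn0 hne fun G hG => ?_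
    obtain ⟨Q, hQ, he⟩ := hsub h.1 hG
    have htop : FamilyFree (coverFamily F q) (⊤ : SimpleGraph (Fin q)) :=
      (familyFree_coverFamily_iff F ⊤).2 fun S hS hSq =>
        absurd ((vertexCoverNum_eq_iff hbip hA).1 h.2 S hS) (by lia)
    have hle := (mem_EX_iff.1 hQ).2 ⊤ htop
    have hQtop : Q = ⊤ := by
      rw [← edgeFinset_inj]
      exact Finset.eq_of_subset_of_card_le (edgeFinset_mono le_top) (by convert hle)
    rwa [hQtop] at he

end Main

end SpectralTree

theorem theorem1p5 {V : Type*} [Fintype V] [DecidableEq V] (F : SimpleGraph V) (hF : F.IsTree)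
    (A B : Finset V) (hbip : F.IsBipartiteWith (A : Set V) (B : Set V))
    (hunion : A ∪ B = Finset.univ) (hcard : A.card ≤ B.card)
    (q : ℕ) (hA : A.card = q + 1) (hq : 1 ≤ q) :
    ∃ N : ℕ, ∀ n : ℕ, N ≤ n →
      (SpectralTree.SPEX n F ⊆
          SpectralTree.joinFamily n q (SpectralTree.coverFamily F q) ↔
        SpectralTree.minDegreeOn F A = 1) ∧
      (SpectralTree.SPEX n F =
          SpectralTree.isoClass n (completeBipartiteGraph (Fin q) (Fin (n - q))) ↔
        SpectralTree.minDegreeOn F A = 1 ∧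
          SpectralTree.EX q (SpectralTree.coverFamily F q) =
            SpectralTree.isoClass q (⊥ : SimpleGraph (Fin q))) ∧
      (SpectralTree.SPEX n F = SpectralTree.isoClass n (SpectralTree.S0 n q) ↔
        SpectralTree.minDegreeOn F A = 1 ∧
          F.vertexCoverNum = ((q + 1 : ℕ) : ℕ∞)) := by
  exact SpectralTree.SPEX_characterization hF hbip (by convert hunion) hcard hA hq
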